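/- Let $\mathbb{K}$ be a field and $q\in\mathbb{K}$. All posets and graphs below are finite, possibly empty, and are considered up to isomorphism. \textbf{Notation.} Let $\sigma: V\supseteq A\hookrightarrow W$ be an injection from a subset $A$ of a finite set $V$ to a finite set $W$, and let $V\sqcup_\sigma W=(V\sqcup W)/(a=\sigma(a),\ a\in A)$. \begin{itemize} \item For posets $P,Q$ and $\sigma:V(P)\supseteq A\hookrightarrow V(Q)$, $P\sqcup_\sigma Q$ is the set $V(P)\sqcup_\sigma V(Q)$ with the transitive closure of the union of (the images of) $\leq_P$ and $\leq_Q$. It is a quasi-order, not necessarily an order. \item A simple graph is an oriented graph without loops, with at most one edge from $i$ to $j$ for any vertices $i,j$. It has no cycle if there are no distinct vertices $i_1,\ldots,i_k$, $k\geq 2$, with edges $i_1\to i_2\to\cdots\to i_k\to i_1$. For simple graphs $G,H$ and $\sigma:V(G)\supseteq A\hookrightarrow V(H)$, $G\sqcup_\sigma H$ is the simple graph on $V(G)\sqcup_\sigma V(H)$ whose edges are the (images of the) edges of $G$ and $H$, multiple edges being reduced to one edge and loops being deleted. \item An ideal of a poset $P$ (respectively of a simple graph $G$) is a set $A$ of vertices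 such that $i\in A$ and $i\leq_P j$ (respectively $i\in A$ and $i\to j$ in $G$) imply $j\in A$. The set of ideals is denoted by $I(P)$ (respectively $I(G)$), and ${}_{\mid A}$ denotes the restriction to $A$. \end{itemize} \textbf{Theorem.} Let $H_{\mathcal{P}}$ and $H_{\mathcal{NCSG}}$ be the vector spaces with bases the isomorphism classes of posets and of simple graphs with no cycle, respectively. \begin{enumerate} \item $H_{\mathcal{P}}$ is a Hopf algebra, with the product and coproduct given, for any posets $P,Q$, by \[P\cdot_q Q=\sum_{\substack{\sigma:V(P)\supseteq A\hookrightarrow V(Q),\\ P\sqcup_\sigma Q\text{ poset}}}q^{|A|}\,P\sqcup_\sigma Q,\qquad \Delta(P)=\sum_{A\in I(P)}P_{\mid V(P)\setminus A}\otimes P_{\mid A}.\] \item $H_{\mathcal{NCSG}}$ is a Hopf algebra, with the product and coproduct given, for any simple graphs with no cycle $G,H$, by \[G\cdot_q H=\sum_{\substack{\sigma:V(G)\supseteq A\hookrightarrow V(H),\\ G\sqcup_\sigma H\text{ with no cycle}}}q^{|A|}\,G\sqcup_\sigma H,\qquad \Delta(G)=\sum_{A\in I(G)}G_{\mid V(G)\setminus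 A}\otimes G_{\mid A},\] and the linear map $H_{\mathcal{NCSG}}\to H_{\mathcal{P}}$ sending $G$ to the poset $(V(G),\leq_G)$, where $i\leq_G j$ if there is a (possibly empty) path from $i$ to $j$ in $G$, is a Hopf algebra morphism from $(H_{\mathcal{NCSG}},\cdot_q,\Delta)$ to $(H_{\mathcal{P}},\cdot_q,\Delta)$. \item (Noncommutative version.) Statements 1 and 2 also hold, with the same formulas, for the vector spaces $\mathbf{H}_{\mathcal{P}}$ and $\mathbf{H}_{\mathcal{NCSG}}$ with bases the isomorphism classes of ordered posets and of ordered simple graphs with no cycle, that is to say of such objects with an additional, arbitrary total order on the set of vertices. Here restrictions are given the restricted total order; the total order of $(V(G),\leq_G)$ is that of $G$; and the total order of a gluing is defined by $x\leq y$ if $\min\pi^{-1}(x)\leq\min\pi^{-1}(y)$, where $\pi:V\sqcup W\to V\sqcup_\sigma W$ is the canonical surjection and $V\sqcup W$ is totally ordered by the orders of $V$ and $W$, all elements of $V$ being smaller than those of $W$. \end{enumerate} -/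

import Mathlib

open scoped TensorProduct

universe u

namespace GluingHopf

/-! ### Finite sets with a relation, gluings, restrictions, ideals -/

/-- A finite set (possibly empty) with a binary relation. -/
structure FinRel : Type 1 where
  V : Type
  [fintype : Fintype V]
  rel : V → V → Prop

attribute [instance] FinRel.fintype

/-- A partial injection `σ : V ⊇ A ↪ W`: a subset `A` of `V` and an injection from `A` to `W`. -/
def PartialInj (V W : Type) : Type := Σ A : Finset V, (A ↪ W)

noncomputable instance (V W : Type) [Fintype V] [Fintype W] : Fintype (PartialInj V W) := by
  classical
  unfold PartialInj
  infer_instance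

/-- The cardinality of the domain `A` of `σ : V ⊇ A ↪ W`. -/
def PartialInj.card {V W : Type} (σ : PartialInj V W) : ℕ := σ.1.card

/-- `V ⊔_σ W`, the quotient of the disjoint union `V ⊔ W` by the identifications `a = σ a`
for `a` in the domain of `σ`. -/
def Glued {V W : Type} (σ : PartialInj V W) : Type :=
  Quot (fun x y : V ⊕ W => ∃ a : σ.1, x = Sum.inl (a : V) ∧ y = Sum.inr (σ.2 a))

/-- The canonical surjection `V ⊔ W → V ⊔_σ W`. -/
def Glued.mk {V W : Type} (σ : PartialInj V W) (x : V ⊕ W) : Glued σ := Quot.mk _ x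

theorem Glued.mk_surjective {V W : Type} (σ : PartialInj V W) :
    Function.Surjective (Glued.mk σ) := Quot.mk_surjective

noncomputable instance {V W : Type} [Fintype V] [Fintype W] (σ : PartialInj V W) :
    Fintype (Glued σ) :=
  have : Finite (Glued σ) := Finite.of_surjective _ (Glued.mk_surjective σ)
  Fintype.ofFinite _

namespace FinRel

/-- The union on `V(P) ⊔_σ V(Q)` of (the images of) the relations of `P` and `Q`. -/
def unionRel (P Q : FinRel) (σ : PartialInj P.V Q.V) (x y : Glued σ) : Prop :=
  Relation.Map P.rel (fun i => Glued.mk σ (Sum.inl i)) (fun i => Glued.mk σ (Sum.inl i)) x y ∨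
  Relation.Map Q.rel (fun i => Glued.mk σ (Sum.inr i)) (fun i => Glued.mk σ (Sum.inr i)) x y

/-- The gluing `P ⊔_σ Q` of two (quasi-)posets: the relation on `V(P) ⊔_σ V(Q)` is the transitive
closure of the union of the relations of `P` and `Q`. -/
noncomputable def orderGlue (P Q : FinRel) (σ : PartialInj P.V Q.V) : FinRel where
  V := Glued σ
  rel := Relation.TransGen (unionRel P Q σ)

/-- The gluing `S(G ⊔_σ H)` of two simple oriented graphs: the edges of `G` and of `H`, with
multiple edges reduced to a single one and loops deleted. -/
noncomputable def graphGlue (G H : FinRel) (σ : PartialInj G.V H.V) : FinRel where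
  V := Glued σ
  rel x y := x ≠ y ∧ unionRel G H σ x y

/-- The restriction to a subset `A`. -/
noncomputable def restrict (P : FinRel) (A : Set P.V) : FinRel where
  V := A
  fintype := Fintype.ofFinite A
  rel x y := P.rel x y

/-- `A` is an ideal if `i ∈ A` and `rel i j` imply `j ∈ A`. -/
def IsIdeal (P : FinRel) (A : Set P.V) : Prop := ∀ i j, i ∈ A → P.rel i j → j ∈ A

/-- The relation is a (partial) order. -/
def IsPoset (P : FinRel) : Prop := IsPartialOrder P.V P.rel

/-- Seeing `rel` as the set of edges of an oriented graph without multiple edges: there is no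
loop. -/
def IsSimple (G : FinRel) : Prop := ∀ i, ¬ G.rel i i

/-- A cycle: distinct vertices `c 0, …, c (n - 1)` with `n = k + 2 ≥ 2` and edges
`c 0 → c 1 → ⋯ → c (n - 1) → c 0` (addition in `Fin n` is modulo `n`). -/
def HasCycle (G : FinRel) : Prop :=
  ∃ (k : ℕ) (c : Fin (k + 2) → G.V), Function.Injective c ∧ ∀ i, G.rel (c i) (c (i + 1))

/-- The relation "there is a (possibly empty) path from `i` to `j`". -/
def pathOrder (G : FinRel) : FinRel where
  V := G.V
  rel := Relation.ReflTransGen G.rel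

theorem IsPoset.restrict {P : FinRel} (h : P.IsPoset) (A : Set P.V) : (P.restrict A).IsPoset := by
  have h' : IsPartialOrder P.V P.rel := h
  exact
    { refl := fun x => h'.refl x.1
      trans := fun x y z => h'.trans x.1 y.1 z.1
      antisymm := fun x y hxy hyx => Subtype.ext (h'.antisymm x.1 y.1 hxy hyx) }

theorem IsSimple.restrict {G : FinRel} (h : G.IsSimple) (A : Set G.V) :
    (G.restrict A).IsSimple := fun i => h i.1

theorem not_hasCycle_restrict {G : FinRel} (h : ¬ G.HasCycle) (A : Set G.V) :
    ¬ (G.restrict A).HasCycle := by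
  rintro ⟨k, c, hc, hr⟩
  exact h ⟨k, fun i => (c i).1, fun i j hij => hc (Subtype.ext hij), hr⟩

theorem exists_walk_of_reflTransGen {α : Type} {r : α → α → Prop} {x y : α}
    (h : Relation.ReflTransGen r x y) :
    ∃ (n : ℕ) (f : ℕ → α), f 0 = x ∧ f n = y ∧ ∀ i < n, r (f i) (f (i + 1)) := by
  induction h with
  | refl => exact ⟨0, fun _ => x, rfl, rfl, by simp⟩
  | @tail b c _ hbc ih =>
    obtain ⟨n, f, h0, hn, hf⟩ := ih
    refine ⟨n + 1, fun i => if i ≤ n then f i else c, by simp [h0], by simp, ?_⟩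
    intro i hi
    rcases Nat.lt_succ_iff_lt_or_eq.mp hi with h | h
    · simpa [h.le, Nat.succ_le_of_lt h] using hf i h
    · subst h
      simpa [hn] using hbc

/-- In a loopless graph without cycles, the only closed walk through a vertex is the empty one. -/
theorem not_closed_walk {G : FinRel} (hs : G.IsSimple) (hc : ¬ G.HasCycle) (n : ℕ) (f : ℕ → G.V)
    (hn : 0 < n) (h0 : f 0 = f n) (hf : ∀ i < n, G.rel (f i) (f (i + 1))) : False := by
  induction n using Nat.strong_induction_on generalizing f with
  | _ n ih =>
    by_cases hinj : ∀ i j, i < j → j < n → f i ≠ f j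
    · match n, hn with
      | 1, _ =>
        have := hf 0 one_pos
        rw [zero_add, ← h0] at this
        exact hs _ this
      | k + 2, _ =>
        refine hc ⟨k, fun i => f i, ?_, ?_⟩
        · intro i j hij
          rcases lt_trichotomy i j with h | h | h
          · exact absurd hij (hinj _ _ h j.2)
          · exact h
          · exact absurd hij.symm (hinj _ _ h i.2)
        · intro i
          have hi := hf i i.2
          rcases Nat.lt_or_ge (i.1 + 1) (k + 2) with h | h
          · have : ((i + 1 : Fin (k + 2)) : ℕ) = i + 1 := by
              rw [Fin.val_add, Fin.val_one, Nat.mod_eq_of_lt h]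
            simpa [this] using hi
          · have h' : i.1 + 1 = k + 2 := le_antisymm i.2 h
            have : ((i + 1 : Fin (k + 2)) : ℕ) = 0 := by
              rw [Fin.val_add, Fin.val_one, h', Nat.mod_self]
            simp only [this]
            rw [h', ← h0] at hi
            exact hi
    · push Not at hinj
      obtain ⟨i, j, hij, hj, he⟩ := hinj
      refine ih (j - i) (by omega) (fun m => f (i + m)) (by omega) ?_ ?_
      · simpa [Nat.add_sub_cancel' hij.le] using he
      · intro m hm
        exact hf (i + m) (by omega)

theorem pathOrder_isPoset {G : FinRel} (hs : G.IsSimple) (hc : ¬ G.HasCycle) :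
    G.pathOrder.IsPoset := by
  refine { refl := fun x => Relation.ReflTransGen.refl
           trans := fun x y z => Relation.ReflTransGen.trans
           antisymm := ?_ }
  intro x y hxy hyx
  by_contra hne
  obtain ⟨z, hxz, hzy⟩ := (Relation.ReflTransGen.cases_head hxy).resolve_left hne
  obtain ⟨n, f, h0, hn, hf⟩ := exists_walk_of_reflTransGen (hzy.trans hyx)
  refine not_closed_walk hs hc (n + 1) (fun m => if m = 0 then x else f (m - 1)) (by omega)
    (by simpa using hn.symm) ?_
  intro i hi
  rcases Nat.eq_zero_or_pos i with rfl | hpos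
  · simpa [h0] using hxz
  · have := hf (i - 1) (by omega)
    rw [Nat.sub_add_cancel hpos] at this
    simpa [hpos.ne'] using this

end FinRel

/-! ### Total orders on the vertices of a gluing -/

section Total

variable {V W : Type} {σ : PartialInj V W}

/-- `a` is the smallest element of the fibre of `V ⊔ W → V ⊔_σ W` over `x`, where `V ⊔ W` is
ordered by `s` on `V`, by `t` on `W`, the elements of `V` being smaller than those of `W`. -/
def IsFirst (s : V → V → Prop) (t : W → W → Prop) (x : Glued σ) (a : V ⊕ W) : Prop :=
  Glued.mk σ a = x ∧ ∀ b, Glued.mk σ b = x → Sum.Lex s t a b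

/-- The total order of a gluing: `x ≤ y` if the minimum of the fibre over `x` is at most the
minimum of the fibre over `y`. -/
def glueTot (s : V → V → Prop) (t : W → W → Prop) (x y : Glued σ) : Prop :=
  ∃ a b, IsFirst s t x a ∧ IsFirst s t y b ∧ Sum.Lex s t a b

theorem lex_isLinearOrder {s : V → V → Prop} {t : W → W → Prop}
    (hs : IsLinearOrder V s) (ht : IsLinearOrder W t) : IsLinearOrder (V ⊕ W) (Sum.Lex s t) where
  refl := by
    rintro (a | a)
    · exact Sum.Lex.inl (hs.refl a)
    · exact Sum.Lex.inr (ht.refl a)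
  trans := by
    rintro _ _ _ (⟨h1⟩ | ⟨h1⟩ | _) (⟨h2⟩ | ⟨h2⟩ | _)
    · exact Sum.Lex.inl (hs.trans _ _ _ h1 ‹_›)
    · exact Sum.Lex.sep _ _
    · exact Sum.Lex.inr (ht.trans _ _ _ h1 ‹_›)
    · exact Sum.Lex.sep _ _
  antisymm := by
    rintro _ _ (⟨h1⟩ | ⟨h1⟩ | _) h
    · cases h with | inl h2 => rw [hs.antisymm _ _ h1 h2]
    · cases h with | inr h2 => rw [ht.antisymm _ _ h1 h2]
    · cases h
  total := by
    rintro (a | a) (b | b)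
    · exact (hs.total a b).imp Sum.Lex.inl Sum.Lex.inl
    · exact Or.inl (Sum.Lex.sep _ _)
    · exact Or.inr (Sum.Lex.sep _ _)
    · exact (ht.total a b).imp Sum.Lex.inr Sum.Lex.inr

theorem exists_isFirst [Finite V] [Finite W] {s : V → V → Prop} {t : W → W → Prop}
    (hs : IsLinearOrder V s) (ht : IsLinearOrder W t) (x : Glued σ) : ∃ a, IsFirst s t x a := by
  have hl := lex_isLinearOrder hs ht
  let r : V ⊕ W → V ⊕ W → Prop := fun a b => Sum.Lex s t a b ∧ ¬ Sum.Lex s t b a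
  have : IsTrans (V ⊕ W) r :=
    ⟨fun a b c h1 h2 => ⟨hl.trans _ _ _ h1.1 h2.1, fun h => h1.2 (hl.trans _ _ _ h2.1 h)⟩⟩
  have : Std.Irrefl r := ⟨fun a h => h.2 h.1⟩
  have wf : WellFounded r := Finite.wellFounded_of_trans_of_irrefl r
  obtain ⟨a, ha, hm⟩ := wf.has_min {a | Glued.mk σ a = x} (Glued.mk_surjective σ x)
  refine ⟨a, ha, fun b hb => ?_⟩
  by_contra h
  exact hm b hb ⟨(hl.total a b).resolve_left h, h⟩

theorem glueTot_isLinearOrder [Finite V] [Finite W] {s : V → V → Prop} {t : W → W → Prop}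
    (hs : IsLinearOrder V s) (ht : IsLinearOrder W t) :
    IsLinearOrder (Glued σ) (glueTot s t) := by
  have hl := lex_isLinearOrder hs ht
  have uniq : ∀ (x : Glued σ) a b, IsFirst s t x a → IsFirst s t x b → a = b :=
    fun x a b h1 h2 => hl.antisymm _ _ (h1.2 b h2.1) (h2.2 a h1.1)
  exact
    { refl := fun x => by
        obtain ⟨a, ha⟩ := exists_isFirst hs ht x
        exact ⟨a, a, ha, ha, hl.refl a⟩
      trans := by
        rintro x y z ⟨a, b, ha, hb, hab⟩ ⟨b', c, hb', hc, hbc⟩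
        rw [uniq y b' b hb' hb] at hbc
        exact ⟨a, c, ha, hc, hl.trans _ _ _ hab hbc⟩
      antisymm := by
        rintro x y ⟨a, b, ha, hb, hab⟩ ⟨b', a', hb', ha', hba⟩
        rw [uniq y b' b hb' hb, uniq x a' a ha' ha] at hba
        rw [← ha.1, ← hb.1, hl.antisymm _ _ hab hba]
      total := fun x y => by
        obtain ⟨a, ha⟩ := exists_isFirst hs ht x
        obtain ⟨b, hb⟩ := exists_isFirst hs ht y
        exact (hl.total a b).imp (fun h => ⟨a, b, ha, hb, h⟩) (fun h => ⟨b, a, hb, ha, h⟩) }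

theorem restrict_isLinearOrder {s : V → V → Prop} (hs : IsLinearOrder V s) (A : Set V) :
    IsLinearOrder A (fun x y : A => s x y) where
  refl x := hs.refl x.1
  trans x y z := hs.trans x.1 y.1 z.1
  antisymm x y hxy hyx := Subtype.ext (hs.antisymm x.1 y.1 hxy hyx)
  total x y := hs.total x.1 y.1

end Total

/-! ### Posets -/

/-- A finite poset. -/
structure FinPoset extends FinRel where
  isPoset : toFinRel.IsPoset

instance FinPoset.setoid : Setoid FinPoset where
  r P Q := Nonempty (P.rel ≃r Q.rel)
  iseqv := ⟨fun P => ⟨RelIso.refl P.rel⟩, fun ⟨e⟩ => ⟨e.symm⟩, fun ⟨e⟩ ⟨f⟩ => ⟨e.trans f⟩⟩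

/-- Isomorphism classes of finite posets. -/
abbrev FinPoset.IsoClass : Type 1 := Quotient FinPoset.setoid

noncomputable def FinPoset.restrict (P : FinPoset) (A : Set P.V) : FinPoset where
  toFinRel := P.toFinRel.restrict A
  isPoset := P.isPoset.restrict A

/-- `H_P`: the vector space with basis the isomorphism classes of finite posets. -/
abbrev HPoset (K : Type u) [Field K] : Type (max 1 u) := FinPoset.IsoClass →₀ K

/-- The basis element of `H_P` attached to a poset. -/
noncomputable def FinPoset.elt (K : Type u) [Field K] (P : FinPoset) : HPoset K :=
  Finsupp.single ⟦P⟧ 1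

open Classical in
/-- The sum, over all `σ : V(P) ⊇ A ↪ V(Q)` such that `P ⊔_σ Q` is a poset, of
`q ^ |A| • (P ⊔_σ Q)`. -/
noncomputable def FinPoset.product {K : Type u} [Field K] (q : K) (P Q : FinPoset) : HPoset K :=
  ∑ σ : {σ : PartialInj P.V Q.V // (P.toFinRel.orderGlue Q.toFinRel σ).IsPoset},
    q ^ σ.1.card • FinPoset.elt K ⟨P.toFinRel.orderGlue Q.toFinRel σ.1, σ.2⟩

open Classical in
/-- The sum, over all ideals `A` of `P`, of `P|(V(P) \ A) ⊗ P|A`. -/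
noncomputable def FinPoset.coproduct (K : Type u) [Field K] (P : FinPoset) :
    HPoset K ⊗[K] HPoset K :=
  ∑ A : {A : Set P.V // P.IsIdeal A}, (P.restrict A.1ᶜ).elt K ⊗ₜ[K] (P.restrict A.1).elt K

/-! ### Simple oriented graphs with no cycle -/

/-- A finite simple oriented graph (no loop, at most one edge from `i` to `j`) with no cycle. -/
structure AcyclicGraph extends FinRel where
  isSimple : toFinRel.IsSimple
  acyclic : ¬ toFinRel.HasCycle

instance AcyclicGraph.setoid : Setoid AcyclicGraph where
  r G H := Nonempty (G.rel ≃r H.rel)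
  iseqv := ⟨fun G => ⟨RelIso.refl G.rel⟩, fun ⟨e⟩ => ⟨e.symm⟩, fun ⟨e⟩ ⟨f⟩ => ⟨e.trans f⟩⟩

/-- Isomorphism classes of simple oriented graphs with no cycle. -/
abbrev AcyclicGraph.IsoClass : Type 1 := Quotient AcyclicGraph.setoid

noncomputable def AcyclicGraph.restrict (G : AcyclicGraph) (A : Set G.V) : AcyclicGraph where
  toFinRel := G.toFinRel.restrict A
  isSimple := G.isSimple.restrict A
  acyclic := FinRel.not_hasCycle_restrict G.acyclic A

/-- `H_NCSG`: the vector space with basis the isomorphism classes of simple oriented graphs with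
no cycle. -/
abbrev HGraph (K : Type u) [Field K] : Type (max 1 u) := AcyclicGraph.IsoClass →₀ K

/-- The basis element of `H_NCSG` attached to a graph. -/
noncomputable def AcyclicGraph.elt (K : Type u) [Field K] (G : AcyclicGraph) : HGraph K :=
  Finsupp.single ⟦G⟧ 1

theorem FinRel.graphGlue_isSimple (G H : FinRel) (σ : PartialInj G.V H.V) :
    (G.graphGlue H σ).IsSimple := fun _ h => h.1 rfl

open Classical in
/-- The sum, over all `σ : V(G) ⊇ A ↪ V(H)` such that `G ⊔_σ H` has no cycle, of
`q ^ |A| • S(G ⊔_σ H)`. -/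
noncomputable def AcyclicGraph.product {K : Type u} [Field K] (q : K) (G H : AcyclicGraph) :
    HGraph K :=
  ∑ σ : {σ : PartialInj G.V H.V // ¬ (G.toFinRel.graphGlue H.toFinRel σ).HasCycle},
    q ^ σ.1.card • AcyclicGraph.elt K
      ⟨G.toFinRel.graphGlue H.toFinRel σ.1, FinRel.graphGlue_isSimple _ _ _, σ.2⟩

open Classical in
/-- The sum, over all ideals `A` of `G`, of `G|(V(G) \ A) ⊗ G|A`. -/
noncomputable def AcyclicGraph.coproduct (K : Type u) [Field K] (G : AcyclicGraph) :
    HGraph K ⊗[K] HGraph K :=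
  ∑ A : {A : Set G.V // G.IsIdeal A}, (G.restrict A.1ᶜ).elt K ⊗ₜ[K] (G.restrict A.1).elt K

/-- The poset `(V(G), ≤_G)`, where `i ≤_G j` if there is a path from `i` to `j`. -/
def AcyclicGraph.toPoset (G : AcyclicGraph) : FinPoset where
  toFinRel := G.toFinRel.pathOrder
  isPoset := FinRel.pathOrder_isPoset G.isSimple G.acyclic

/-! ### Ordered posets -/

/-- An ordered finite poset: a finite poset with an additional total order `tot` on its set of
vertices (not required to be compatible with the partial order). -/
structure OrdFinPoset extends FinPoset where
  tot : V → V → Prop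
  isLinearOrder : IsLinearOrder V tot

instance OrdFinPoset.setoid : Setoid OrdFinPoset where
  r P Q := ∃ e : P.rel ≃r Q.rel, ∀ x y, Q.tot (e x) (e y) ↔ P.tot x y
  iseqv :=
    ⟨fun P => ⟨RelIso.refl P.rel, fun _ _ => Iff.rfl⟩,
      fun {P Q} ⟨e, he⟩ => ⟨e.symm, fun x y => by
        rw [← he, e.apply_symm_apply, e.apply_symm_apply]⟩,
      fun ⟨e, he⟩ ⟨f, hf⟩ => ⟨e.trans f, fun x y => (hf _ _).trans (he _ _)⟩⟩

/-- Isomorphism classes of ordered finite posets. -/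
abbrev OrdFinPoset.IsoClass : Type 1 := Quotient OrdFinPoset.setoid

noncomputable def OrdFinPoset.restrict (P : OrdFinPoset) (A : Set P.V) : OrdFinPoset where
  toFinPoset := P.toFinPoset.restrict A
  tot := fun x y : A => P.tot x y
  isLinearOrder := restrict_isLinearOrder P.isLinearOrder A

/-- The vector space with basis the isomorphism classes of ordered finite posets. -/
abbrev HOrdPoset (K : Type u) [Field K] : Type (max 1 u) := OrdFinPoset.IsoClass →₀ K

noncomputable def OrdFinPoset.elt (K : Type u) [Field K] (P : OrdFinPoset) : HOrdPoset K :=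
  Finsupp.single ⟦P⟧ 1

open Classical in
/-- The sum, over all `σ : V(P) ⊇ A ↪ V(Q)` such that `P ⊔_σ Q` is a poset, of
`q ^ |A| • (P ⊔_σ Q)`, as ordered posets. -/
noncomputable def OrdFinPoset.product {K : Type u} [Field K] (q : K) (P Q : OrdFinPoset) :
    HOrdPoset K :=
  ∑ σ : {σ : PartialInj P.V Q.V // (P.toFinRel.orderGlue Q.toFinRel σ).IsPoset},
    q ^ σ.1.card • OrdFinPoset.elt K
      { toFinRel := P.toFinRel.orderGlue Q.toFinRel σ.1
        isPoset := σ.2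
        tot := glueTot P.tot Q.tot
        isLinearOrder := glueTot_isLinearOrder P.isLinearOrder Q.isLinearOrder }

open Classical in
noncomputable def OrdFinPoset.coproduct (K : Type u) [Field K] (P : OrdFinPoset) :
    HOrdPoset K ⊗[K] HOrdPoset K :=
  ∑ A : {A : Set P.V // P.IsIdeal A}, (P.restrict A.1ᶜ).elt K ⊗ₜ[K] (P.restrict A.1).elt K

/-! ### Ordered simple oriented graphs with no cycle -/

/-- An ordered simple oriented graph with no cycle: a simple oriented graph with no cycle, with
a total order `tot` on its set of vertices (not required to be compatible with the edges). -/
structure OrdAcyclicGraph extends AcyclicGraph where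
  tot : V → V → Prop
  isLinearOrder : IsLinearOrder V tot

instance OrdAcyclicGraph.setoid : Setoid OrdAcyclicGraph where
  r G H := ∃ e : G.rel ≃r H.rel, ∀ x y, H.tot (e x) (e y) ↔ G.tot x y
  iseqv :=
    ⟨fun G => ⟨RelIso.refl G.rel, fun _ _ => Iff.rfl⟩,
      fun {G H} ⟨e, he⟩ => ⟨e.symm, fun x y => by
        rw [← he, e.apply_symm_apply, e.apply_symm_apply]⟩,
      fun ⟨e, he⟩ ⟨f, hf⟩ => ⟨e.trans f, fun x y => (hf _ _).trans (he _ _)⟩⟩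

/-- Isomorphism classes of ordered simple oriented graphs with no cycle. -/
abbrev OrdAcyclicGraph.IsoClass : Type 1 := Quotient OrdAcyclicGraph.setoid

noncomputable def OrdAcyclicGraph.restrict (G : OrdAcyclicGraph) (A : Set G.V) : OrdAcyclicGraph where
  toAcyclicGraph := G.toAcyclicGraph.restrict A
  tot := fun x y : A => G.tot x y
  isLinearOrder := restrict_isLinearOrder G.isLinearOrder A

/-- The vector space with basis the isomorphism classes of ordered simple oriented graphs with
no cycle. -/
abbrev HOrdGraph (K : Type u) [Field K] : Type (max 1 u) := OrdAcyclicGraph.IsoClass →₀ K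

noncomputable def OrdAcyclicGraph.elt (K : Type u) [Field K] (G : OrdAcyclicGraph) :
    HOrdGraph K :=
  Finsupp.single ⟦G⟧ 1

open Classical in
/-- The sum, over all `σ : V(G) ⊇ A ↪ V(H)` such that `G ⊔_σ H` has no cycle, of
`q ^ |A| • S(G ⊔_σ H)`, as ordered graphs. -/
noncomputable def OrdAcyclicGraph.product {K : Type u} [Field K] (q : K)
    (G H : OrdAcyclicGraph) : HOrdGraph K :=
  ∑ σ : {σ : PartialInj G.V H.V // ¬ (G.toFinRel.graphGlue H.toFinRel σ).HasCycle},
    q ^ σ.1.card • OrdAcyclicGraph.elt K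
      { toFinRel := G.toFinRel.graphGlue H.toFinRel σ.1
        isSimple := FinRel.graphGlue_isSimple _ _ _
        acyclic := σ.2
        tot := glueTot G.tot H.tot
        isLinearOrder := glueTot_isLinearOrder G.isLinearOrder H.isLinearOrder }

open Classical in
noncomputable def OrdAcyclicGraph.coproduct (K : Type u) [Field K] (G : OrdAcyclicGraph) :
    HOrdGraph K ⊗[K] HOrdGraph K :=
  ∑ A : {A : Set G.V // G.IsIdeal A}, (G.restrict A.1ᶜ).elt K ⊗ₜ[K] (G.restrict A.1).elt K

/-- The ordered poset `(V(G), ≤_G)`, with the same total order on the vertices. -/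
def OrdAcyclicGraph.toOrdPoset (G : OrdAcyclicGraph) : OrdFinPoset where
  toFinPoset := G.toAcyclicGraph.toPoset
  tot := G.tot
  isLinearOrder := G.isLinearOrder

end GluingHopf

/-! ### Bialgebras given by their structure maps -/

/-! All axioms are verified for one family only, the ordered acyclic graphs. The other three spaces
are quotients of that one: forgetting the total order gives acyclic graphs, and taking path orders
gives posets, with or without total orders. These maps respect the operations because a gluing of
graphs is acyclic exactly when the gluing of the path orders is antisymmetric
(`not_hasCycle_graphGlue_iff`), and because a graph and its path order have the same ideals. They
are onto, since a poset is the path order of its strict-order graph, so the axioms descend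
(`IsBialgebra.of_surjective`). The morphisms of the theorem are the path-order maps themselves.

For ordered graphs, a graph with a cycle is counted as zero (`dagElt`). This is consistent: a cycle
of a factor survives in every gluing, and given an ideal, a graph with a cycle has one inside the
ideal or inside its complement. Sums then run over all partial injections, with no side condition. A
partial injection amounts to the set of coincidences between two injections into a common set; these
determine the gluing up to isomorphism (`IsGluing.exists_iso`), and the exponent of `q` is the
number of vertices lost. Hence: - associativity (`sum_glue_assoc`): both sides sum over the gluings
of three graphs, weighted by the vertices lost in total; - compatibility (`sum_copSum_glue`): an
ideal of a gluing traces an ideal on each factor, and identifications never cross its boundary, so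
they split into two independent partial injections; - coassociativity (`sum_copSum_restrict`): both
sides sum over nested pairs of ideals.

For the antipode, each convolution factor `η ∘ ε - id` uses up at least one vertex, so its powers
vanish locally (`augPow_dagElt`), and its geometric series is a convolution inverse of the identity
(`exists_convInverse`). -/

/-- The structure maps of a bialgebra, without any axiom. -/
structure BialgOps (K M : Type*) [Field K] [AddCommGroup M] [Module K M] where
  mul : M →ₗ[K] M →ₗ[K] M
  one : M
  comul : M →ₗ[K] M ⊗[K] M
  counit : M →ₗ[K] K

namespace BialgOps

section Axioms

variable {K M N : Type*} [Field K] [AddCommGroup M] [Module K M] [AddCommGroup N] [Module K N]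

/-- The bialgebra axioms. -/
structure IsBialgebra (d : BialgOps K M) : Prop where
  mul_assoc : ∀ x y z, d.mul (d.mul x y) z = d.mul x (d.mul y z)
  one_mul : ∀ x, d.mul d.one x = x
  mul_one : ∀ x, d.mul x d.one = x
  coassoc : ∀ x, TensorProduct.assoc K M M M (d.comul.rTensor M (d.comul x)) =
    d.comul.lTensor M (d.comul x)
  rTensor_counit : ∀ x, d.counit.rTensor M (d.comul x) = 1 ⊗ₜ x
  lTensor_counit : ∀ x, d.counit.lTensor M (d.comul x) = x ⊗ₜ 1
  counit_one : d.counit d.one = 1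
  counit_mul : ∀ x y, d.counit (d.mul x y) = d.counit x * d.counit y
  comul_one : d.comul d.one = d.one ⊗ₜ d.one
  comul_mul : ∀ x y, d.comul (d.mul x y) =
    TensorProduct.map₂ d.mul d.mul (d.comul x) (d.comul y)

/-- The convolution powers of `η ∘ ε - id`. -/
noncomputable def augPow (d : BialgOps K M) : ℕ → M →ₗ[K] M
  | 0 => d.counit.smulRight d.one
  | n + 1 => TensorProduct.lift d.mul ∘ₗ
      TensorProduct.map (d.counit.smulRight d.one - LinearMap.id) (d.augPow n) ∘ₗ d.comul

/-- Each element is killed by all large convolution powers of `η ∘ ε - id`. -/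
def IsConilpotent (d : BialgOps K M) : Prop := ∀ x, ∃ n, ∀ m, n ≤ m → d.augPow m x = 0

/-- Compatibility of a linear map with the structure maps. -/
structure IsHom (d : BialgOps K M) (e : BialgOps K N) (f : M →ₗ[K] N) : Prop where
  map_mul : ∀ x y, f (d.mul x y) = e.mul (f x) (f y)
  map_one : f d.one = e.one
  map_comul : ∀ x, e.comul (f x) = TensorProduct.map f f (d.comul x)
  map_counit : ∀ x, e.counit (f x) = d.counit x

variable {d : BialgOps K M} {e : BialgOps K N} {f : M →ₗ[K] N}

/-- A morphism intertwines convolution, which is built from the product and the coproduct alone.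
This is what lets local nilpotency descend to quotients. -/
theorem IsHom.map_augPow (h : IsHom d e f) (n : ℕ) (x : M) :
    e.augPow n (f x) = f (d.augPow n x) := by
  induction n generalizing x with
  | zero => simp [augPow, h.map_counit, h.map_one]
  | succ n ih =>
    simp only [augPow, LinearMap.comp_apply, h.map_comul]
    induction d.comul x using TensorProduct.induction_on with
    | zero => simp
    | add a b ha hb => simp only [map_add, ha, hb]
    | tmul a b => simp [ih, h.map_mul, h.map_counit, h.map_one]

theorem IsConilpotent.of_surjective (h : IsHom d e f) (hf : Function.Surjective f)
    (hd : d.IsConilpotent) : e.IsConilpotent := by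
  intro y
  obtain ⟨x, rfl⟩ := hf y
  obtain ⟨n, hn⟩ := hd x
  exact ⟨n, fun m hm => by rw [h.map_augPow, hn m hm, map_zero]⟩

/-- Each axiom for `e` is the image under tensor powers of `f` of the same axiom for `d`, and
surjectivity makes every argument an image. -/
theorem IsBialgebra.of_surjective (h : IsHom d e f) (hf : Function.Surjective f)
    (hd : d.IsBialgebra) : e.IsBialgebra where
  mul_assoc x y z := by
    obtain ⟨x, rfl⟩ := hf x
    obtain ⟨y, rfl⟩ := hf y
    obtain ⟨z, rfl⟩ := hf z
    simp only [← h.map_mul, hd.mul_assoc]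
  one_mul x := by
    obtain ⟨x, rfl⟩ := hf x
    rw [← h.map_one, ← h.map_mul, hd.one_mul]
  mul_one x := by
    obtain ⟨x, rfl⟩ := hf x
    rw [← h.map_one, ← h.map_mul, hd.mul_one]
  coassoc x := by
    obtain ⟨x, rfl⟩ := hf x
    have key := congrArg (TensorProduct.map f (TensorProduct.map f f)) (hd.coassoc x)
    rw [h.map_comul]
    convert key using 1
    · induction d.comul x using TensorProduct.induction_on with
      | zero => simp
      | add a b ha hb => simp only [map_add, ha, hb]
      | tmul a b =>
        simp only [TensorProduct.map_tmul, LinearMap.rTensor_tmul, h.map_comul]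
        induction d.comul a using TensorProduct.induction_on with
        | zero => simp
        | add a b ha hb => simp only [map_add, TensorProduct.add_tmul, ha, hb]
        | tmul a b => simp
    · induction d.comul x using TensorProduct.induction_on with
      | zero => simp
      | add a b ha hb => simp only [map_add, ha, hb]
      | tmul a b => simp [h.map_comul]
  rTensor_counit x := by
    obtain ⟨x, rfl⟩ := hf x
    have key := congrArg (f.lTensor K) (hd.rTensor_counit x)
    rw [h.map_comul]
    rw [LinearMap.lTensor_tmul] at key
    rw [← key]
    induction d.comul x using TensorProduct.induction_on with
    | zero => simp
    | add a b ha hb => simp only [map_add, ha, hb]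
    | tmul a b => simp [h.map_counit]
  lTensor_counit x := by
    obtain ⟨x, rfl⟩ := hf x
    have key := congrArg (f.rTensor K) (hd.lTensor_counit x)
    rw [h.map_comul]
    rw [LinearMap.rTensor_tmul] at key
    rw [← key]
    induction d.comul x using TensorProduct.induction_on with
    | zero => simp
    | add a b ha hb => simp only [map_add, ha, hb]
    | tmul a b => simp [h.map_counit]
  counit_one := by rw [← h.map_one, h.map_counit, hd.counit_one]
  counit_mul x y := by
    obtain ⟨x, rfl⟩ := hf x
    obtain ⟨y, rfl⟩ := hf y
    rw [← h.map_mul, h.map_counit, h.map_counit, h.map_counit, hd.counit_mul]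
  comul_one := by rw [← h.map_one, h.map_comul, hd.comul_one, TensorProduct.map_tmul]
  comul_mul x y := by
    obtain ⟨x, rfl⟩ := hf x
    obtain ⟨y, rfl⟩ := hf y
    rw [← h.map_mul, h.map_comul, h.map_comul, h.map_comul, hd.comul_mul]
    induction d.comul x using TensorProduct.induction_on with
    | zero => simp
    | add a b ha hb => simp only [map_add, LinearMap.add_apply, ha, hb]
    | tmul a b =>
      induction d.comul y using TensorProduct.induction_on with
      | zero => simp
      | add a b ha hb => simp only [map_add, ha, hb]
      | tmul a b => simp [h.map_mul]

end Axioms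

end BialgOps

/-! ### The antipode of a conilpotent bialgebra -/

section Antipode

open WithConv

variable {K H : Type*} [Field K] [Ring H] [Bialgebra K H]

/-- The geometric series of an endomorphism whose convolution powers vanish locally. -/
noncomputable def convGeomSeries (v : WithConv (H →ₗ[K] H))
    (hv : ∀ x, ∃ n, ∀ m, n ≤ m → (v ^ m) x = 0) : H →ₗ[K] H where
  toFun x := ∑ᶠ k : ℕ, (v ^ k) x
  map_add' x y := by
    have fin : ∀ x, (Function.support fun k : ℕ => (v ^ k) x).Finite := fun x => by
      obtain ⟨n, hn⟩ := hv x
      refine (Set.finite_lt_nat n).subset fun k hk => ?_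
      by_contra h
      exact hk (hn k (not_lt.mp h))
    simp only [map_add]
    exact finsum_add_distrib (fin x) (fin y)
  map_smul' c x := by
    simp only [map_smul, RingHom.id_apply]
    exact (smul_finsum c _).symm

/-- Any truncation past the vanishing threshold computes the series, so several vectors can share a
single truncation. -/
theorem convGeomSeries_apply (v : WithConv (H →ₗ[K] H))
    (hv : ∀ x, ∃ n, ∀ m, n ≤ m → (v ^ m) x = 0) (x : H) (n : ℕ)
    (hn : ∀ m, n ≤ m → (v ^ m) x = 0) :
    convGeomSeries v hv x = (∑ k ∈ Finset.range n, v ^ k) x := by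
  have : convGeomSeries v hv x = ∑ k ∈ Finset.range n, (v ^ k) x := by
    refine finsum_eq_sum_of_support_subset _ fun k hk => ?_
    by_contra h
    exact hk (hn k (by simpa using h))
  rw [this]
  simp [ofConv_sum]

/-- With `v = 1 - id` in the convolution ring, `id = 1 - v` is inverted by the series of the powers
of `v`. At a given `x`, the convolution sees only the finitely many tensor factors of the coproduct
of `x`, so a finite geometric sum can replace the series; it telescopes to `1 - v ^ N`, and `v ^ N`
kills `x`. -/
theorem exists_convInverse (hv : ∀ x : H, ∃ n, ∀ m, n ≤ m →
      ((1 - toConv LinearMap.id : WithConv (H →ₗ[K] H)) ^ m) x = 0) :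
    ∃ S : H →ₗ[K] H, toConv S * toConv LinearMap.id = 1 ∧ toConv LinearMap.id * toConv S = 1 := by
  set v : WithConv (H →ₗ[K] H) := 1 - toConv LinearMap.id with hvdef
  have hid : (toConv LinearMap.id : WithConv (H →ₗ[K] H)) = 1 - v := by rw [hvdef]; abel
  choose n hn using hv
  have bound : ∀ x : H, ∃ N, (∀ i ∈ (Coalgebra.Repr.arbitrary K x).index,
      convGeomSeries v (fun x => ⟨n x, hn x⟩) ((Coalgebra.Repr.arbitrary K x).left i) =
        (∑ k ∈ Finset.range N, v ^ k) ((Coalgebra.Repr.arbitrary K x).left i) ∧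
      convGeomSeries v (fun x => ⟨n x, hn x⟩) ((Coalgebra.Repr.arbitrary K x).right i) =
        (∑ k ∈ Finset.range N, v ^ k) ((Coalgebra.Repr.arbitrary K x).right i)) ∧
      (v ^ N) x = 0 := by
    intro x
    let R := Coalgebra.Repr.arbitrary K x
    -- The sum of the three thresholds dominates each of them: the one for `x`, those for the left
    -- factors and those for the right factors.
    refine ⟨n x + R.index.sup (fun i => n (R.left i)) + R.index.sup (fun i => n (R.right i)),
      fun i hi => ⟨?_, ?_⟩, hn _ _ (by omega)⟩
    · have h : n (R.left i) ≤ R.index.sup (fun i => n (R.left i)) :=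
        Finset.le_sup (f := fun i => n (R.left i)) hi
      exact convGeomSeries_apply _ _ _ _ fun m hm => hn (R.left i) _ (by omega)
    · have h : n (R.right i) ≤ R.index.sup (fun i => n (R.right i)) :=
        Finset.le_sup (f := fun i => n (R.right i)) hi
      exact convGeomSeries_apply _ _ _ _ fun m hm => hn (R.right i) _ (by omega)
  refine ⟨convGeomSeries v fun x => ⟨n x, hn x⟩, ?_, ?_⟩
  · ext x
    obtain ⟨N, hN, h0⟩ := bound x
    have h2 : ((∑ k ∈ Finset.range N, v ^ k) * toConv LinearMap.id : WithConv (H →ₗ[K] H)) x =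
        (1 : WithConv (H →ₗ[K] H)) x := by
      rw [hid, geom_sum_mul_neg, ofConv_sub, LinearMap.sub_apply, h0, sub_zero]
    rw [← h2, (Coalgebra.Repr.arbitrary K x).convMul_apply,
      (Coalgebra.Repr.arbitrary K x).convMul_apply]
    exact Finset.sum_congr rfl fun i hi => by rw [← (hN i hi).1]
  · ext x
    obtain ⟨N, hN, h0⟩ := bound x
    have h2 : (toConv LinearMap.id * (∑ k ∈ Finset.range N, v ^ k) : WithConv (H →ₗ[K] H)) x =
        (1 : WithConv (H →ₗ[K] H)) x := by
      rw [hid, mul_neg_geom_sum, ofConv_sub, LinearMap.sub_apply, h0, sub_zero]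
    rw [← h2, (Coalgebra.Repr.arbitrary K x).convMul_apply,
      (Coalgebra.Repr.arbitrary K x).convMul_apply]
    exact Finset.sum_congr rfl fun i hi => by rw [← (hN i hi).2]

/-- A morphism of bialgebras between Hopf algebras commutes with the antipodes. -/
theorem BialgHom.map_antipode {A B : Type*} [Ring A] [Ring B] [HopfAlgebra K A] [HopfAlgebra K B]
    (φ : A →ₐc[K] B) (x : A) :
    φ (HopfAlgebra.antipode K x) = HopfAlgebra.antipode K (φ x) := by
  -- In the convolution ring of linear maps from `A` to `B`, both `φ ∘ S` and `S ∘ φ` invert `φ`,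
  -- one on the left and one on the right, so they agree.
  let a : WithConv (A →ₗ[K] B) := toConv (φ : A →ₐ[K] B).toLinearMap
  let l : WithConv (A →ₗ[K] B) :=
    toConv ((φ : A →ₐ[K] B).toLinearMap ∘ₗ HopfAlgebra.antipode K)
  let r : WithConv (A →ₗ[K] B) := toConv (HopfAlgebra.antipode K ∘ₗ (φ : A →ₐ[K] B).toLinearMap)
  have hl : l * a = 1 := by
    have := LinearMap.algHom_comp_convMul_distrib (φ : A →ₐ[K] B)
      (toConv (HopfAlgebra.antipode K)) (toConv (LinearMap.id : A →ₗ[K] A))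
    rw [LinearMap.antipode_mul_id] at this
    apply WithConv.ofConv_injective
    refine this.symm.trans ?_
    ext x
    exact (φ : A →ₐ[K] B).commutes _
  have hr : a * r = 1 := by
    have := LinearMap.convMul_comp_coalgHom_distrib (toConv (LinearMap.id : B →ₗ[K] B))
      (toConv (HopfAlgebra.antipode K)) (φ : A →ₗc[K] B)
    rw [LinearMap.id_mul_antipode] at this
    apply WithConv.ofConv_injective
    refine this.symm.trans ?_
    ext x
    simp
  exact congr($(left_inv_eq_right_inv hl hr) x)

end Antipode

/-! ### From bare structure maps to Hopf algebra instances, on a copy without prior multiplication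
-/

namespace BialgOps

variable {K M N : Type*} [Field K] [AddCommGroup M] [Module K M] [AddCommGroup N] [Module K N]

/-- A copy of the underlying vector space, bearing the algebra and coalgebra structures. -/
def Carrier (_ : BialgOps K M) : Type _ := M

variable {d : BialgOps K M} {e : BialgOps K N}

instance : AddCommGroup d.Carrier := inferInstanceAs (AddCommGroup M)

instance : Module K d.Carrier := inferInstanceAs (Module K M)

/-- The identification of the vector space with its copy. -/
def toCarrier (d : BialgOps K M) : M ≃ₗ[K] d.Carrier := LinearEquiv.refl K M

/-- The ring structure on the copy. -/
abbrev ring (h : d.IsBialgebra) : Ring d.Carrier where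
  __ := (inferInstance : AddCommGroup d.Carrier)
  mul x y := d.mul x y
  one := d.one
  mul_assoc := h.mul_assoc
  one_mul := h.one_mul
  mul_one := h.mul_one
  zero_mul x := LinearMap.map_zero₂ d.mul x
  mul_zero x := map_zero (d.mul x)
  left_distrib x y z := map_add (d.mul x) y z
  right_distrib x y z := LinearMap.map_add₂ d.mul x y z

/-- The algebra structure on the copy. -/
noncomputable abbrev algebra (h : d.IsBialgebra) : letI := ring h; Algebra K d.Carrier :=
  letI := ring h
  Algebra.ofModule (fun r x y => LinearMap.map_smul₂ d.mul r x y)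
    (fun r x y => map_smul (d.mul x) r y)

/-- The coalgebra structure on the copy. -/
noncomputable abbrev coalgebra (h : d.IsBialgebra) : Coalgebra K d.Carrier where
  comul := d.comul
  counit := d.counit
  coassoc := LinearMap.ext h.coassoc
  rTensor_counit_comp_comul := LinearMap.ext h.rTensor_counit
  lTensor_counit_comp_comul := LinearMap.ext h.lTensor_counit

/-- The bialgebra structure on the copy. -/
noncomputable abbrev bialgebra (h : d.IsBialgebra) :
    letI := ring h; Bialgebra K d.Carrier :=
  letI := ring h
  letI := algebra h
  letI := coalgebra h
  Bialgebra.mk' K d.Carrier h.counit_one (h.counit_mul _ _) h.comul_one (by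
    intro a b
    refine (h.comul_mul a b).trans ?_
    change _ = Algebra.TensorProduct.mul (R := K) (A := d.Carrier) (B := d.Carrier)
      (d.comul a) (d.comul b)
    unfold Algebra.TensorProduct.mul
    rfl)

/-- `augPow` needs no ring instance, so it can be transported and computed on the bare structure
maps; here it is matched with the powers in the convolution ring, where the antipode is built. -/
theorem augPow_eq (h : d.IsBialgebra) (n : ℕ) (x : d.Carrier) :
    let := ring h
    let := bialgebra h
    ((1 - WithConv.toConv LinearMap.id : WithConv (d.Carrier →ₗ[K] d.Carrier)) ^ n) x =
      d.augPow n x := by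
  let := ring h
  let := bialgebra h
  have h1 : ∀ x : d.Carrier, (1 : WithConv (d.Carrier →ₗ[K] d.Carrier)) x =
      d.counit x • (1 : d.Carrier) := fun x => Algebra.algebraMap_eq_smul_one (R := K) (A := d.Carrier) (d.counit x)
  induction n generalizing x with
  | zero => exact h1 x
  | succ n ih =>
    intro _ _
    rw [pow_succ', LinearMap.convMul_apply]
    change _ = TensorProduct.lift d.mul (TensorProduct.map _ _ (d.comul x))
    change LinearMap.mul' K d.Carrier (TensorProduct.map _ _ (d.comul x)) = _
    generalize d.comul x = t
    have : ((1 - WithConv.toConv LinearMap.id : WithConv (d.Carrier →ₗ[K] d.Carrier)) ^ n).ofConv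
        = d.augPow n := LinearMap.ext ih
    rw [this]
    have : (1 - WithConv.toConv LinearMap.id : WithConv (d.Carrier →ₗ[K] d.Carrier)).ofConv
        = d.counit.smulRight d.one - LinearMap.id :=
      LinearMap.ext fun x => congrArg (· - x) (h1 x)
    rw [this]
    rfl

/-- A morphism between conilpotent bialgebras given by their structure maps is a morphism of
Hopf algebras. -/
theorem exists_hopfAlgebra {M N : Type u} [AddCommGroup M] [Module K M] [AddCommGroup N]
    [Module K N] {d : BialgOps K M} {e : BialgOps K N} (hd : d.IsBialgebra)
    (hd' : d.IsConilpotent) (he : e.IsBialgebra) (he' : e.IsConilpotent) {f : M →ₗ[K] N}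
    (hf : IsHom d e f) :
    ∃ (HG : Type u) (_ : Ring HG) (_ : HopfAlgebra K HG)
      (HP : Type u) (_ : Ring HP) (_ : HopfAlgebra K HP) (g : M ≃ₗ[K] HG) (p : N ≃ₗ[K] HP),
      (∀ x y, p x * p y = p (e.mul x y)) ∧
      (∀ x, Coalgebra.comul (R := K) (p x) =
        TensorProduct.map p.toLinearMap p.toLinearMap (e.comul x)) ∧
      (∀ x y, g x * g y = g (d.mul x y)) ∧
      (∀ x, Coalgebra.comul (R := K) (g x) =
        TensorProduct.map g.toLinearMap g.toLinearMap (d.comul x)) ∧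
      ∃ φ : HG →ₐc[K] HP, (∀ x, φ (g x) = p (f x)) ∧
        ∀ x : HG, φ (HopfAlgebra.antipode K x) = HopfAlgebra.antipode K (φ x) := by
  let := ring hd
  let := ring he
  let := bialgebra hd
  let := bialgebra he
  obtain ⟨S, hS, hS'⟩ := exists_convInverse (K := K) (H := d.Carrier) fun x => by
    obtain ⟨n, hn⟩ := hd' x
    exact ⟨n, fun m hm => by rw [augPow_eq hd]; exact hn m hm⟩
  obtain ⟨T, hT, hT'⟩ := exists_convInverse (K := K) (H := e.Carrier) fun x => by
    obtain ⟨n, hn⟩ := he' x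
    exact ⟨n, fun m hm => by rw [augPow_eq he]; exact hn m hm⟩
  let := HopfAlgebra.ofConvInverse S hS hS'
  let := HopfAlgebra.ofConvInverse T hT hT'
  refine ⟨d.Carrier, ring hd, inferInstance, e.Carrier, ring he, inferInstance,
    d.toCarrier, e.toCarrier, fun _ _ => rfl, fun x => ?_, fun _ _ => rfl, fun x => ?_, ?_⟩
  · exact congr($(TensorProduct.map_id (R := K) (M := N) (N := N)) (e.comul x)).symm
  · exact congr($(TensorProduct.map_id (R := K) (M := M) (N := M)) (d.comul x)).symm
  · let φ : d.Carrier →ₐc[K] e.Carrier :=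
      { toFun := f
        map_add' := map_add f
        map_smul' := map_smul f
        counit_comp := LinearMap.ext hf.map_counit
        map_comp_comul := LinearMap.ext fun x => (hf.map_comul x).symm
        map_one' := hf.map_one
        map_mul' := hf.map_mul }
    exact ⟨φ, fun _ => rfl, φ.map_antipode⟩

end BialgOps

/-! ### Structure maps given on isomorphism classes of objects -/

/-- The vector space with basis the classes of objects. -/
abbrev ClassSpace (K : Type*) [Field K] (X : Type*) [s : Setoid X] : Type _ := Quotient s →₀ K

/-- A product, a coproduct, a unit and a counit for objects, with values in the vector space
with basis the classes of objects. -/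
structure ObjOps (K : Type*) [Field K] (X : Type*) [Setoid X] where
  prod : X → X → ClassSpace K X
  cop : X → ClassSpace K X ⊗[K] ClassSpace K X
  one : X
  counit : X → K

namespace ObjOps

variable {K : Type*} [Field K] {X Y : Type*} [Setoid X] [Setoid Y]

variable (K) in
/-- The basis element attached to an object. -/
noncomputable abbrev basisElt (x : X) : ClassSpace K X := Finsupp.single ⟦x⟧ 1

theorem linearMap_ext {N : Type*} [AddCommMonoid N] [Module K N] {f g : ClassSpace K X →ₗ[K] N}
    (h : ∀ x, f (basisElt K x) = g (basisElt K x)) : f = g :=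
  Finsupp.lhom_ext' fun a => LinearMap.ext_ring (Quotient.inductionOn a h)

/-- The operations do not depend on the representatives. -/
structure Respects (b : ObjOps K X) : Prop where
  prod_congr : ∀ x x' y y', x ≈ x' → y ≈ y' → b.prod x y = b.prod x' y'
  cop_congr : ∀ x x', x ≈ x' → b.cop x = b.cop x'
  counit_congr : ∀ x x', x ≈ x' → b.counit x = b.counit x'

/-- The linear extension of operations on objects. -/
noncomputable def toBialgOps (b : ObjOps K X) : BialgOps K (ClassSpace K X) where
  mul := Finsupp.linearCombination K fun x =>
    Finsupp.linearCombination K fun y => b.prod x.out y.out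
  one := basisElt K b.one
  comul := Finsupp.linearCombination K fun x => b.cop x.out
  counit := Finsupp.linearCombination K fun x => b.counit x.out

variable {b : ObjOps K X} {c : ObjOps K Y}

theorem Respects.mul_elt (h : b.Respects) (x y : X) :
    b.toBialgOps.mul (basisElt K x) (basisElt K y) = b.prod x y := by
  simp only [toBialgOps, Finsupp.linearCombination_single, one_smul]
  exact h.prod_congr _ _ _ _ (Quotient.mk_out x) (Quotient.mk_out y)

theorem Respects.comul_elt (h : b.Respects) (x : X) :
    b.toBialgOps.comul (basisElt K x) = b.cop x := by
  simp only [toBialgOps, Finsupp.linearCombination_single, one_smul]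
  exact h.cop_congr _ _ (Quotient.mk_out x)

theorem Respects.counit_elt (h : b.Respects) (x : X) :
    b.toBialgOps.counit (basisElt K x) = b.counit x := by
  simp only [toBialgOps, Finsupp.linearCombination_single, one_smul]
  exact h.counit_congr _ _ (Quotient.mk_out x)

/-- It is enough to check the bialgebra axioms on objects. -/
theorem Respects.isBialgebra (h : b.Respects)
    (mul_assoc : ∀ x y z, b.toBialgOps.mul (b.prod x y) (basisElt K z) =
      b.toBialgOps.mul (basisElt K x) (b.prod y z))
    (one_mul : ∀ x, b.prod b.one x = basisElt K x)
    (mul_one : ∀ x, b.prod x b.one = basisElt K x)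
    (coassoc : ∀ x, TensorProduct.assoc K _ _ _ (b.toBialgOps.comul.rTensor _ (b.cop x)) =
      b.toBialgOps.comul.lTensor _ (b.cop x))
    (rTensor_counit : ∀ x, b.toBialgOps.counit.rTensor _ (b.cop x) = 1 ⊗ₜ basisElt K x)
    (lTensor_counit : ∀ x, b.toBialgOps.counit.lTensor _ (b.cop x) = basisElt K x ⊗ₜ 1)
    (counit_one : b.counit b.one = 1)
    (counit_mul : ∀ x y, b.toBialgOps.counit (b.prod x y) = b.counit x * b.counit y)
    (comul_one : b.cop b.one = basisElt K b.one ⊗ₜ basisElt K b.one)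
    (comul_mul : ∀ x y, b.toBialgOps.comul (b.prod x y) =
      TensorProduct.map₂ b.toBialgOps.mul b.toBialgOps.mul (b.cop x) (b.cop y)) :
    b.toBialgOps.IsBialgebra := by
  have hm := h.mul_elt
  have hΔ := h.comul_elt
  have hε := h.counit_elt
  set d := b.toBialgOps
  have hone : d.one = basisElt K b.one := rfl
  constructor
  · intro x y z
    have : d.mul.compr₂ d.mul = (LinearMap.llcomp K _ _ _).flip d.mul ∘ₗ
        (LinearMap.llcomp K _ _ _ ∘ₗ d.mul) := by
      refine linearMap_ext fun x => linearMap_ext fun y => linearMap_ext fun z => ?_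
      simpa [hm] using mul_assoc x y z
    exact congr($this x y z)
  · have : d.mul d.one = LinearMap.id := linearMap_ext fun x => by
      rw [hone, hm, one_mul, LinearMap.id_apply]
    exact fun x => congr($this x)
  · have : d.mul.flip d.one = LinearMap.id := linearMap_ext fun x => by
      rw [hone, LinearMap.flip_apply, hm, mul_one, LinearMap.id_apply]
    exact fun x => congr($this x)
  · have : (TensorProduct.assoc K _ _ _).toLinearMap ∘ₗ d.comul.rTensor _ ∘ₗ d.comul =
        d.comul.lTensor _ ∘ₗ d.comul := linearMap_ext fun x => by
      simpa [hΔ] using coassoc x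
    exact fun x => congr($this x)
  · have : d.counit.rTensor _ ∘ₗ d.comul = TensorProduct.mk K K _ 1 := linearMap_ext fun x => by
      simpa [hΔ] using rTensor_counit x
    exact fun x => congr($this x)
  · have : d.counit.lTensor _ ∘ₗ d.comul = (TensorProduct.mk K _ K).flip 1 :=
      linearMap_ext fun x => by simpa [hΔ] using lTensor_counit x
    exact fun x => congr($this x)
  · rw [hone, hε, counit_one]
  · have : d.mul.compr₂ d.counit = (LinearMap.mul K K).compl₁₂ d.counit d.counit := by
      refine linearMap_ext fun x => linearMap_ext fun y => ?_
      simpa [hm, hε] using counit_mul x y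
    exact fun x y => congr($this x y)
  · rw [hone, hΔ, comul_one]
  · have : d.mul.compr₂ d.comul =
        (TensorProduct.map₂ d.mul d.mul).compl₁₂ d.comul d.comul := by
      refine linearMap_ext fun x => linearMap_ext fun y => ?_
      simpa [hm, hΔ] using comul_mul x y
    exact fun x y => congr($this x y)

/-- The vanishing thresholds need not be uniform: a vector is a finite combination of basis
elements, and the maximum of finitely many thresholds works. -/
theorem isConilpotent_of_elt {d : BialgOps K (ClassSpace K X)}
    (h : ∀ x : X, ∃ n, ∀ m, n ≤ m → d.augPow m (basisElt K x) = 0) : d.IsConilpotent := by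
  intro x
  induction x using Finsupp.induction_linear with
  | zero => exact ⟨0, fun m _ => map_zero _⟩
  | add a b ha hb =>
    obtain ⟨k, hk⟩ := ha
    obtain ⟨l, hl⟩ := hb
    exact ⟨max k l, fun m hm => by
      rw [map_add, hk m (le_of_max_le_left hm), hl m (le_of_max_le_right hm), add_zero]⟩
  | single a r =>
    induction a using Quotient.inductionOn with | _ a =>
    obtain ⟨k, hk⟩ := h a
    refine ⟨k, fun m hm => ?_⟩
    rw [← mul_one r, ← smul_eq_mul, ← Finsupp.smul_single, map_smul, hk m hm, smul_zero]

/-! ### Transport along maps of objects that lift isomorphisms -/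

section Map

/-- A map between objects that lifts isomorphisms. -/
structure IsCover (F : X → Y) : Prop where
  map_equiv : ∀ x x', x ≈ x' → F x ≈ F x'
  lift_equiv : ∀ y y', y ≈ y' → ∃ x x', x ≈ x' ∧ F x = y ∧ F x' = y'

variable {F : X → Y}

variable (K) in
/-- The linear map induced by a map between objects. -/
noncomputable def IsCover.linearMap (hF : IsCover F) : ClassSpace K X →ₗ[K] ClassSpace K Y :=
  Finsupp.lmapDomain K K (Quotient.map F hF.map_equiv)

theorem IsCover.linearMap_elt (hF : IsCover F) (x : X) :
    hF.linearMap K (basisElt K x) = basisElt K (F x) := by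
  simp [IsCover.linearMap, Finsupp.mapDomain_single]

theorem IsCover.linearMap_surjective (hF : IsCover F) :
    Function.Surjective (hF.linearMap K) := by
  refine Finsupp.mapDomain_surjective fun y => ?_
  induction y using Quotient.inductionOn with | _ y =>
  obtain ⟨x, _, _, rfl, _⟩ := hF.lift_equiv y y (Setoid.refl y)
  exact ⟨⟦x⟧, rfl⟩

/-- Compatibility of a map between objects with the operations. -/
structure IsCover.Compatible (hF : IsCover F) (b : ObjOps K X) (c : ObjOps K Y) : Prop where
  prod : ∀ x x', c.prod (F x) (F x') = hF.linearMap K (b.prod x x')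
  cop : ∀ x, c.cop (F x) = TensorProduct.map (hF.linearMap K) (hF.linearMap K) (b.cop x)
  one : F b.one ≈ c.one
  counit : ∀ x, c.counit (F x) = b.counit x

/-- Invariance under isomorphism downstairs follows from invariance upstairs because isomorphic
pairs lift to isomorphic pairs; lifting single objects would not be enough. -/
theorem IsCover.Compatible.respects {hF : IsCover F} (h : hF.Compatible b c) (hb : b.Respects) :
    c.Respects where
  prod_congr x x' y y' hx hy := by
    obtain ⟨a, a', ha, rfl, rfl⟩ := hF.lift_equiv x x' hx
    obtain ⟨e, e', he, rfl, rfl⟩ := hF.lift_equiv y y' hy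
    rw [h.prod, h.prod, hb.prod_congr _ _ _ _ ha he]
  cop_congr x x' hx := by
    obtain ⟨a, a', ha, rfl, rfl⟩ := hF.lift_equiv x x' hx
    rw [h.cop, h.cop, hb.cop_congr _ _ ha]
  counit_congr x x' hx := by
    obtain ⟨a, a', ha, rfl, rfl⟩ := hF.lift_equiv x x' hx
    rw [h.counit, h.counit, hb.counit_congr _ _ ha]

theorem IsCover.Compatible.isHom {hF : IsCover F} (h : hF.Compatible b c) (hb : b.Respects) :
    BialgOps.IsHom b.toBialgOps c.toBialgOps (hF.linearMap K) := by
  have hc := h.respects hb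
  constructor
  · have : b.toBialgOps.mul.compr₂ (hF.linearMap K) =
        c.toBialgOps.mul.compl₁₂ (hF.linearMap K) (hF.linearMap K) := by
      refine linearMap_ext fun x => linearMap_ext fun y => ?_
      simp [hb.mul_elt, hc.mul_elt, hF.linearMap_elt, h.prod]
    exact fun x y => congr($this x y)
  · exact (hF.linearMap_elt b.one).trans (congrArg (Finsupp.single · 1) (Quotient.sound h.one))
  · have : c.toBialgOps.comul ∘ₗ hF.linearMap K =
        TensorProduct.map (hF.linearMap K) (hF.linearMap K) ∘ₗ b.toBialgOps.comul :=
      linearMap_ext fun x => by simp [hb.comul_elt, hc.comul_elt, hF.linearMap_elt, h.cop]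
    exact fun x => congr($this x)
  · have : c.toBialgOps.counit ∘ₗ hF.linearMap K = b.toBialgOps.counit :=
      linearMap_ext fun x => by simp [hb.counit_elt, hc.counit_elt, hF.linearMap_elt, h.counit]
    exact fun x => congr($this x)

/-- Operations that respect isomorphisms, and whose linear extensions are those of a conilpotent
bialgebra. -/
structure IsHopf (b : ObjOps K X) : Prop where
  respects : b.Respects
  isBialgebra : b.toBialgOps.IsBialgebra
  isConilpotent : b.toBialgOps.IsConilpotent

theorem IsCover.Compatible.isHopf {hF : IsCover F} (h : hF.Compatible b c) (hb : b.IsHopf) :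
    c.IsHopf where
  respects := h.respects hb.respects
  isBialgebra := hb.isBialgebra.of_surjective (h.isHom hb.respects) hF.linearMap_surjective
  isConilpotent := hb.isConilpotent.of_surjective (h.isHom hb.respects) hF.linearMap_surjective

theorem IsCover.Compatible.exists_hopfAlgebra {K : Type u} [Field K]
    {X Y : Type 1} [Setoid X] [Setoid Y] {F : X → Y} {b : ObjOps K X} {c : ObjOps K Y}
    {hF : IsCover F} (h : hF.Compatible b c) (hb : b.IsHopf) :
    ∃ (HG : Type (max 1 u)) (_ : Ring HG) (_ : HopfAlgebra K HG)
      (HP : Type (max 1 u)) (_ : Ring HP) (_ : HopfAlgebra K HP)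
      (g : ClassSpace K X ≃ₗ[K] HG) (p : ClassSpace K Y ≃ₗ[K] HP),
      (∀ x y : Y, p (basisElt K x) * p (basisElt K y) = p (c.prod x y)) ∧
      (∀ x : Y, Coalgebra.comul (R := K) (p (basisElt K x)) =
        TensorProduct.map p.toLinearMap p.toLinearMap (c.cop x)) ∧
      (∀ x y : X, g (basisElt K x) * g (basisElt K y) = g (b.prod x y)) ∧
      (∀ x : X, Coalgebra.comul (R := K) (g (basisElt K x)) =
        TensorProduct.map g.toLinearMap g.toLinearMap (b.cop x)) ∧
      ∃ φ : HG →ₐc[K] HP, (∀ x : X, φ (g (basisElt K x)) = p (basisElt K (F x))) ∧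
        ∀ x : HG, φ (HopfAlgebra.antipode K x) = HopfAlgebra.antipode K (φ x) := by
  have hc := h.isHopf hb
  obtain ⟨HG, i1, i2, HP, i3, i4, g, p, h1, h2, h3, h4, φ, h5, h6⟩ :=
    BialgOps.exists_hopfAlgebra hb.isBialgebra hb.isConilpotent hc.isBialgebra hc.isConilpotent
      (h.isHom hb.respects)
  refine ⟨HG, i1, i2, HP, i3, i4, g, p, fun x y => ?_, fun x => ?_, fun x y => ?_, fun x => ?_,
    φ, fun x => ?_, h6⟩
  · rw [h1, hc.respects.mul_elt]
  · rw [h2, hc.respects.comul_elt]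
  · rw [h3, hb.respects.mul_elt]
  · rw [h4, hb.respects.comul_elt]
  · rw [h5, hF.linearMap_elt]

end Map

end ObjOps

namespace GluingHopf

/-! ### Partial injections and their gluings -/

section PartialInj

variable {V W Z : Type}

open Classical in
/-- The normal form of an element of the disjoint union modulo the identifications of `σ`. -/
noncomputable def PartialInj.normalForm (σ : PartialInj V W) : V ⊕ W → W ⊕ V
  | Sum.inl v => if h : v ∈ σ.1 then Sum.inl (σ.2 ⟨v, h⟩) else Sum.inr v
  | Sum.inr w => Sum.inl w

/-- The normal form is constant on the generating identifications, hence on classes. Equalities in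
the quotient can then be read off without describing the generated equivalence relation. -/
theorem PartialInj.normalForm_eq_of_mk_eq {σ : PartialInj V W} {x y : V ⊕ W}
    (h : Glued.mk σ x = Glued.mk σ y) : σ.normalForm x = σ.normalForm y := by
  let f : Glued σ → W ⊕ V := Quot.lift σ.normalForm <| by
    rintro _ _ ⟨a, rfl, rfl⟩
    simp [PartialInj.normalForm]
  exact congrArg f h

theorem Glued.mk_inl_eq_inr_iff {σ : PartialInj V W} {v : V} {w : W} :
    Glued.mk σ (Sum.inl v) = Glued.mk σ (Sum.inr w) ↔ ∃ h : v ∈ σ.1, σ.2 ⟨v, h⟩ = w := by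
  constructor
  · intro h
    have h' := PartialInj.normalForm_eq_of_mk_eq h
    simp only [PartialInj.normalForm] at h'
    split_ifs at h' with hv
    exact ⟨hv, Sum.inl.inj h'⟩
  · rintro ⟨h, rfl⟩
    exact Quot.sound ⟨⟨v, h⟩, rfl, rfl⟩

theorem Glued.inl_injective (σ : PartialInj V W) :
    Function.Injective fun v => Glued.mk σ (Sum.inl v) := by
  intro v v' h
  have h' := PartialInj.normalForm_eq_of_mk_eq h
  simp only [PartialInj.normalForm] at h'
  split_ifs at h' with h1 h2
  · exact congrArg Subtype.val (σ.2.injective (Sum.inl.inj h'))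
  · exact Sum.inr.inj h'

theorem Glued.inr_injective (σ : PartialInj V W) :
    Function.Injective fun w => Glued.mk σ (Sum.inr w) := fun _ _ h =>
  Sum.inl.inj (PartialInj.normalForm_eq_of_mk_eq h)

theorem Glued.exists_rep (σ : PartialInj V W) (x : Glued σ) :
    (∃ v, Glued.mk σ (Sum.inl v) = x) ∨ ∃ w, Glued.mk σ (Sum.inr w) = x := by
  obtain ⟨v | w, h⟩ := Glued.mk_surjective σ x
  · exact Or.inl ⟨v, h⟩
  · exact Or.inr ⟨w, h⟩

/-- A partial injection is determined by which left vertices meet which right vertices, so it can be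
compared through its gluing alone. -/
theorem PartialInj.ext_of_mk {σ τ : PartialInj V W}
    (h : ∀ v w, Glued.mk σ (Sum.inl v) = Glued.mk σ (Sum.inr w) ↔
      Glued.mk τ (Sum.inl v) = Glued.mk τ (Sum.inr w)) : σ = τ := by
  simp only [Glued.mk_inl_eq_inr_iff] at h
  obtain ⟨A, f⟩ := σ
  obtain ⟨B, g⟩ := τ
  obtain rfl : A = B := Finset.ext fun v =>
    ⟨fun hv => ((h v _).1 ⟨hv, rfl⟩).1, fun hv => ((h v _).2 ⟨hv, rfl⟩).1⟩
  congr 1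
  ext v
  exact ((h v _).1 ⟨v.2, rfl⟩).2.symm

/-- The domain consists of the `v` whose image also lies in the image of `j`, each matched with its
unique partner. Together with `PartialInj.ext_of_mk`, this replaces explicit constructions of
partial injections by patterns of coincidence. -/
theorem PartialInj.exists_of_maps [Finite V] {i : V → Z} {j : W → Z} (hi : Function.Injective i)
    (hj : Function.Injective j) : ∃ σ : PartialInj V W, ∀ v w,
      Glued.mk σ (Sum.inl v) = Glued.mk σ (Sum.inr w) ↔ i v = j w := by
  classical
  have := Fintype.ofFinite V
  let A : Finset V := Finset.univ.filter fun v => ∃ w, j w = i v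
  have hA : ∀ v : A, ∃ w, j w = i v := fun v => (Finset.mem_filter.1 v.2).2
  choose f hf using hA
  let F : A ↪ W := ⟨f, fun v v' h => Subtype.ext (hi (by rw [← hf v, ← hf v', h]))⟩
  let σ : PartialInj V W := ⟨A, F⟩
  refine ⟨σ, fun v w => ?_⟩
  rw [Glued.mk_inl_eq_inr_iff]
  constructor
  · rintro ⟨h, rfl⟩
    exact (hf ⟨v, h⟩).symm
  · intro h
    have hv : v ∈ A := Finset.mem_filter.2 ⟨Finset.mem_univ _, w, h.symm⟩
    exact ⟨hv, hj ((hf ⟨v, hv⟩).trans h)⟩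

/-- The gluing consists of `W` and the unmatched vertices of `V`. The exponent of `q` is thus
recovered from the sizes of the two factors and of the gluing, which is how powers of `q` are
compared throughout. -/
theorem PartialInj.card_add_card [Fintype V] [Fintype W] (σ : PartialInj V W) :
    Nat.card V + Nat.card W = Nat.card (Glued σ) + σ.card := by
  classical
  let f : W ⊕ {v // v ∉ σ.1} → Glued σ
    | Sum.inl w => Glued.mk σ (Sum.inr w)
    | Sum.inr v => Glued.mk σ (Sum.inl v)
  have hf : Function.Bijective f := by
    constructor
    · rintro (w | v) (w' | v') h
      · exact congrArg _ (Glued.inr_injective σ h)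
      · exact absurd (Glued.mk_inl_eq_inr_iff.1 h.symm).1 v'.2
      · exact absurd (Glued.mk_inl_eq_inr_iff.1 h).1 v.2
      · exact congrArg _ (Subtype.ext (Glued.inl_injective σ h))
    · intro x
      rcases Glued.exists_rep σ x with ⟨v, rfl⟩ | ⟨w, rfl⟩
      · by_cases hv : v ∈ σ.1
        · exact ⟨Sum.inl (σ.2 ⟨v, hv⟩), (Glued.mk_inl_eq_inr_iff.2 ⟨hv, rfl⟩).symm⟩
        · exact ⟨Sum.inr ⟨v, hv⟩, rfl⟩
      · exact ⟨Sum.inl w, rfl⟩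
  rw [← Nat.card_eq_of_bijective f hf, Nat.card_sum]
  have h1 : Nat.card {v // v ∉ σ.1} = Fintype.card V - σ.1.card := by
    rw [Nat.card_eq_fintype_card, Fintype.card_subtype_compl, Fintype.card_coe]
  have h2 := σ.1.card_le_univ
  rw [h1, Nat.card_eq_fintype_card (α := V), PartialInj.card]
  omega

end PartialInj

/-- Sums over two finite types matched by a one-to-one correspondence. -/
theorem sum_eq_sum_of_rel {α β M : Type*} [Fintype α] [Fintype β] [AddCommMonoid M]
    (R : α → β → Prop) (left_total : ∀ a, ∃ b, R a b) (right_total : ∀ b, ∃ a, R a b)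
    (right_unique : ∀ a b b', R a b → R a b' → b = b')
    (left_unique : ∀ a a' b, R a b → R a' b → a = a') {f : α → M} {g : β → M}
    (h : ∀ a b, R a b → f a = g b) : ∑ a, f a = ∑ b, g b := by
  choose F hF using left_total
  refine Fintype.sum_bijective F ⟨fun a a' e => ?_, fun b => ?_⟩ _ _ fun a => h a _ (hF a)
  · have h1 := hF a
    rw [e] at h1
    exact left_unique _ _ _ h1 (hF a')
  · obtain ⟨a, ha⟩ := right_total b
    exact ⟨a, right_unique _ _ _ (hF a) ha⟩

/-! ### Ordered simple graphs -/

/-- A simple oriented graph, possibly with cycles, with a total order on its vertices. -/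
structure OrdGraph extends FinRel where
  isSimple : toFinRel.IsSimple
  tot : V → V → Prop
  isLinearOrder : IsLinearOrder V tot

namespace OrdGraph

/-- The restriction to a set of vertices. -/
noncomputable def restrict (G : OrdGraph) (A : Set G.V) : OrdGraph where
  toFinRel := G.toFinRel.restrict A
  isSimple := G.isSimple.restrict A
  tot := fun x y : A => G.tot x y
  isLinearOrder := restrict_isLinearOrder G.isLinearOrder A

/-- The gluing along a partial injection. -/
noncomputable def glue (G H : OrdGraph) (σ : PartialInj G.V H.V) : OrdGraph where
  toFinRel := G.toFinRel.graphGlue H.toFinRel σ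
  isSimple := FinRel.graphGlue_isSimple _ _ _
  tot := glueTot G.tot H.tot
  isLinearOrder := glueTot_isLinearOrder G.isLinearOrder H.isLinearOrder

/-- The map from the left factor to a gluing. -/
def glueInl (G H : OrdGraph) (σ : PartialInj G.V H.V) (v : G.V) : (G.glue H σ).V :=
  Glued.mk σ (Sum.inl v)

/-- The map from the right factor to a gluing. -/
def glueInr (G H : OrdGraph) (σ : PartialInj G.V H.V) (w : H.V) : (G.glue H σ).V :=
  Glued.mk σ (Sum.inr w)

/-- A map that reflects and preserves all the structure. -/
structure IsEmb {G H : OrdGraph} (f : G.V → H.V) : Prop where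
  inj : Function.Injective f
  rel_iff : ∀ x y, H.rel (f x) (f y) ↔ G.rel x y
  tot_iff : ∀ x y, H.tot (f x) (f y) ↔ G.tot x y

/-- `Z`, with the maps `i` and `j`, is a gluing of `G` and `H`. -/
structure IsGluing (G H Z : OrdGraph) (i : G.V → Z.V) (j : H.V → Z.V) : Prop where
  inl_inj : Function.Injective i
  inr_inj : Function.Injective j
  exists_rep : ∀ z, (∃ v, i v = z) ∨ ∃ w, j w = z
  rel_iff : ∀ z z', Z.rel z z' ↔ (∃ v v', G.rel v v' ∧ i v = z ∧ i v' = z') ∨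
    ∃ w w', H.rel w w' ∧ j w = z ∧ j w' = z'
  tot_inl : ∀ v v', G.tot v v' → Z.tot (i v) (i v')
  tot_inl_inr : ∀ w, (∀ v, i v ≠ j w) → ∀ v, Z.tot (i v) (j w)
  tot_inr : ∀ w w', (∀ v, i v ≠ j w) → (∀ v, i v ≠ j w') → H.tot w w' → Z.tot (j w) (j w')

/-- Fibres have at most one point on each side. The minimum of a fibre is therefore its left point
if there is one, and its right point otherwise, which yields the three order clauses. -/
theorem glue_isGluing (G H : OrdGraph) (σ : PartialInj G.V H.V) :
    IsGluing G H (G.glue H σ) (G.glueInl H σ) (G.glueInr H σ) where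
  inl_inj := Glued.inl_injective σ
  inr_inj := Glued.inr_injective σ
  exists_rep := Glued.exists_rep σ
  rel_iff z z' := by
    -- Deleting loops deletes nothing: both factors embed injectively, so a loop could only come
    -- from a loop of a factor.
    refine ⟨fun h => h.2, fun h => ⟨?_, h⟩⟩
    rintro rfl
    rcases h with ⟨v, v', h, h1, h2⟩ | ⟨v, v', h, h1, h2⟩
    · rw [Glued.inl_injective σ (h1.trans h2.symm)] at h
      exact G.isSimple _ h
    · rw [Glued.inr_injective σ (h1.trans h2.symm)] at h
      exact H.isSimple _ h
  tot_inl v v' h := by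
    have first : ∀ v, IsFirst G.tot H.tot (Glued.mk σ (Sum.inl v)) (Sum.inl v) := fun v => by
      refine ⟨rfl, ?_⟩
      rintro (b | b) hb
      · rw [Glued.inl_injective σ hb]
        exact Sum.Lex.inl (G.isLinearOrder.refl _)
      · exact Sum.Lex.sep _ _
    exact ⟨_, _, first v, first v', Sum.Lex.inl h⟩
  tot_inl_inr w hw v := by
    refine ⟨Sum.inl v, Sum.inr w, ⟨rfl, ?_⟩, ⟨rfl, ?_⟩, Sum.Lex.sep _ _⟩
    · rintro (b | b) hb
      · rw [Glued.inl_injective σ hb]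
        exact Sum.Lex.inl (G.isLinearOrder.refl _)
      · exact Sum.Lex.sep _ _
    · rintro (b | b) hb
      · exact absurd hb (hw b)
      · rw [Glued.inr_injective σ hb]
        exact Sum.Lex.inr (H.isLinearOrder.refl _)
  tot_inr w w' hw hw' h := by
    have first : ∀ w, (∀ v, Glued.mk σ (Sum.inl v) ≠ Glued.mk σ (Sum.inr w)) →
        IsFirst G.tot H.tot (Glued.mk σ (Sum.inr w)) (Sum.inr w) := fun w hw => by
      refine ⟨rfl, ?_⟩
      rintro (b | b) hb
      · exact absurd hb (hw b)
      · rw [Glued.inr_injective σ hb]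
        exact Sum.Lex.inr (H.isLinearOrder.refl _)
    exact ⟨_, _, first w hw, first w' hw', Sum.Lex.inr h⟩

theorem partialInj_ext {G H : OrdGraph} {σ τ : PartialInj G.V H.V}
    (h : ∀ v w, G.glueInl H σ v = G.glueInr H σ w ↔ G.glueInl H τ v = G.glueInr H τ w) : σ = τ :=
  PartialInj.ext_of_mk h

theorem exists_partialInj {G H : OrdGraph} {S : Type} {i : G.V → S} {j : H.V → S}
    (hi : Function.Injective i) (hj : Function.Injective j) :
    ∃ σ : PartialInj G.V H.V, ∀ v w, G.glueInl H σ v = G.glueInr H σ w ↔ i v = j w :=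
  PartialInj.exists_of_maps hi hj

/-! ### Universal property, restriction and reassociation of abstract gluings -/

namespace IsGluing

variable {G H L X Y Z Z' : OrdGraph} {i : G.V → Z.V} {j : H.V → Z.V}

/-- Selects the minimal representative of the fibre, the case split used for every comparison of
total orders. -/
theorem exists_first (h : IsGluing G H Z i j) (z : Z.V) :
    (∃ v, i v = z) ∨ ∃ w, (∀ v, i v ≠ j w) ∧ j w = z := by
  by_cases hz : ∃ v, i v = z
  · exact Or.inl hz
  · obtain ⟨w, rfl⟩ := (h.exists_rep z).resolve_left hz
    exact Or.inr ⟨w, not_exists.1 hz, rfl⟩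

theorem tot_inl_iff (h : IsGluing G H Z i j) {v v' : G.V} :
    Z.tot (i v) (i v') ↔ G.tot v v' := by
  refine ⟨fun h' => ?_, h.tot_inl v v'⟩
  rcases G.isLinearOrder.total v v' with hv | hv
  · exact hv
  · rw [h.inl_inj (Z.isLinearOrder.antisymm _ _ h' (h.tot_inl _ _ hv))]
    exact G.isLinearOrder.refl _

theorem not_tot_inr_inl (h : IsGluing G H Z i j) {w : H.V} (hw : ∀ v, i v ≠ j w) (v : G.V) :
    ¬ Z.tot (j w) (i v) := fun h' =>
  hw v (Z.isLinearOrder.antisymm _ _ (h.tot_inl_inr w hw v) h')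

theorem tot_inr_iff (h : IsGluing G H Z i j) {w w' : H.V} (hw : ∀ v, i v ≠ j w)
    (hw' : ∀ v, i v ≠ j w') : Z.tot (j w) (j w') ↔ H.tot w w' := by
  refine ⟨fun h' => ?_, h.tot_inr w w' hw hw'⟩
  rcases H.isLinearOrder.total w w' with hv | hv
  · exact hv
  · rw [h.inr_inj (Z.isLinearOrder.antisymm _ _ h' (h.tot_inr _ _ hw' hw hv))]
    exact H.isLinearOrder.refl _

theorem rel_inl (h : IsGluing G H Z i j) {v v' : G.V} (hv : G.rel v v') : Z.rel (i v) (i v') :=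
  (h.rel_iff _ _).2 (Or.inl ⟨v, v', hv, rfl, rfl⟩)

theorem rel_inr (h : IsGluing G H Z i j) {w w' : H.V} (hw : H.rel w w') : Z.rel (j w) (j w') :=
  (h.rel_iff _ _).2 (Or.inr ⟨w, w', hw, rfl, rfl⟩)

/-- The universal property of gluings of sets. -/
theorem exists_map (h : IsGluing G H Z i j) {S : Type} {a : G.V → S} {b : H.V → S}
    (ha : Function.Injective a) (hb : Function.Injective b) (hab : ∀ v w, i v = j w ↔ a v = b w) :
    ∃ k : Z.V → S, Function.Injective k ∧ (∀ v, k (i v) = a v) ∧ ∀ w, k (j w) = b w := by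
  have key : ∀ z, ∃ s, (∀ v, i v = z → a v = s) ∧ ∀ w, j w = z → b w = s := by
    intro z
    rcases h.exists_rep z with ⟨v, rfl⟩ | ⟨w, rfl⟩
    · exact ⟨a v, fun v' e => by rw [h.inl_inj e], fun w e => ((hab v w).1 e.symm).symm⟩
    · exact ⟨b w, fun v e => (hab v w).1 e, fun w' e => by rw [h.inr_inj e]⟩
  choose k hk hk' using key
  refine ⟨k, fun z z' e => ?_, fun v => (hk _ v rfl).symm, fun w => (hk' _ w rfl).symm⟩
  rcases h.exists_rep z with ⟨v, rfl⟩ | ⟨w, rfl⟩ <;>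
    rcases h.exists_rep z' with ⟨v', rfl⟩ | ⟨w', rfl⟩
  · rw [← hk _ v rfl, ← hk _ v' rfl] at e
    rw [ha e]
  · rw [← hk _ v rfl, ← hk' _ w' rfl] at e
    exact (hab v w').2 e
  · rw [← hk' _ w rfl, ← hk _ v' rfl] at e
    exact ((hab v' w).2 e.symm).symm
  · rw [← hk' _ w rfl, ← hk' _ w' rfl] at e
    rw [hb e]

/-- Two gluings with the same identifications are isomorphic. -/
theorem exists_iso (h : IsGluing G H Z i j) {i' : G.V → Z'.V} {j' : H.V → Z'.V}
    (h' : IsGluing G H Z' i' j') (hij : ∀ v w, i v = j w ↔ i' v = j' w) :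
    ∃ e : Z.V → Z'.V, Function.Surjective e ∧ IsEmb e ∧ (∀ v, e (i v) = i' v) ∧
      ∀ w, e (j w) = j' w := by
  obtain ⟨e, he, hi, hj⟩ := h.exists_map h'.inl_inj h'.inr_inj hij
  refine ⟨e, fun z => ?_, ⟨he, fun x y => ?_, fun x y => ?_⟩, hi, hj⟩
  · rcases h'.exists_rep z with ⟨v, rfl⟩ | ⟨w, rfl⟩
    exacts [⟨_, hi v⟩, ⟨_, hj w⟩]
  · rw [h.rel_iff, h'.rel_iff]
    simp only [← hi, ← hj, he.eq_iff]
  · have hne : ∀ w, (∀ v, i v ≠ j w) → ∀ v, i' v ≠ j' w :=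
      fun w hw v e => hw v ((hij v w).2 e)
    rcases h.exists_first x with ⟨v, rfl⟩ | ⟨w, hw, rfl⟩ <;>
      rcases h.exists_first y with ⟨v', rfl⟩ | ⟨w', hw', rfl⟩
    · rw [hi, hi, h.tot_inl_iff, h'.tot_inl_iff]
    · rw [hi, hj]
      exact iff_of_true (h'.tot_inl_inr _ (hne _ hw') _) (h.tot_inl_inr _ hw' _)
    · rw [hi, hj]
      exact iff_of_false (h'.not_tot_inr_inl (hne _ hw) _) (h.not_tot_inr_inl hw _)
    · rw [hj, hj, h.tot_inr_iff hw hw', h'.tot_inr_iff (hne _ hw) (hne _ hw')]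

theorem restrict (h : IsGluing G H Z i j) (S : Set Z.V) :
    IsGluing (G.restrict (i ⁻¹' S)) (H.restrict (j ⁻¹' S)) (Z.restrict S)
      (fun v => ⟨i v.1, v.2⟩) (fun w => ⟨j w.1, w.2⟩) := by
  -- A left vertex identified with a point of `S` automatically lies over `S`, so restricting does
  -- not change which right vertices are minimal in their fibres.
  have hne : ∀ w : (H.restrict (j ⁻¹' S)).V,
      (∀ v : (G.restrict (i ⁻¹' S)).V, (⟨i v.1, v.2⟩ : S) ≠ ⟨j w.1, w.2⟩) →
      ∀ v, i v ≠ j w.1 := fun w hw v e =>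
    hw ⟨v, by rw [Set.mem_preimage, e]; exact w.2⟩ (Subtype.ext e)
  refine ⟨fun v v' e => Subtype.ext (h.inl_inj (congrArg Subtype.val e)),
    fun w w' e => Subtype.ext (h.inr_inj (congrArg Subtype.val e)), ?_, ?_,
    fun v v' hv => h.tot_inl _ _ hv, fun w hw v => h.tot_inl_inr _ (hne w hw) _,
    fun w w' hw hw' hr => h.tot_inr _ _ (hne w hw) (hne w' hw') hr⟩
  · rintro ⟨z, hz⟩
    rcases h.exists_rep z with ⟨v, rfl⟩ | ⟨w, rfl⟩
    exacts [Or.inl ⟨⟨v, hz⟩, rfl⟩, Or.inr ⟨⟨w, hz⟩, rfl⟩]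
  · rintro ⟨z, hz⟩ ⟨z', hz'⟩
    refine (h.rel_iff z z').trans (or_congr ⟨?_, ?_⟩ ⟨?_, ?_⟩)
    · rintro ⟨v, v', hr, rfl, rfl⟩
      exact ⟨⟨v, hz⟩, ⟨v', hz'⟩, hr, rfl, rfl⟩
    · rintro ⟨v, v', hr, h1, h2⟩
      exact ⟨v.1, v'.1, hr, congrArg Subtype.val h1, congrArg Subtype.val h2⟩
    · rintro ⟨v, v', hr, rfl, rfl⟩
      exact ⟨⟨v, hz⟩, ⟨v', hz'⟩, hr, rfl, rfl⟩
    · rintro ⟨v, v', hr, h1, h2⟩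
      exact ⟨v.1, v'.1, hr, congrArg Subtype.val h1, congrArg Subtype.val h2⟩

/-- Reassociation of a double gluing to the right. -/
theorem assoc_right {i : G.V → Y.V} {j : H.V → Y.V} {k : Y.V → Z.V} {c : L.V → Z.V}
    {i' : H.V → X.V} {j' : L.V → X.V} {m : X.V → Z.V} (hY : IsGluing G H Y i j)
    (hZ : IsGluing Y L Z k c) (hX : IsGluing H L X i' j') (hm : Function.Injective m)
    (hi : ∀ w, m (i' w) = k (j w)) (hj : ∀ u, m (j' u) = c u) :
    IsGluing G X Z (fun v => k (i v)) m := by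
  -- Under either bracketing, the chosen representative of a class lies in `G` if possible,
  -- otherwise in `H`, otherwise in `L`. The next two facts transfer the absence of an earlier
  -- representative between the bracketings.
  have hw : ∀ w, (∀ v, k (i v) ≠ m (i' w)) → ∀ v, i v ≠ j w :=
    fun w h v e => h v (by rw [hi, e])
  have hu : ∀ u, (∀ v, k (i v) ≠ m (j' u)) → (∀ w, i' w ≠ j' u) → ∀ y, k y ≠ c u := by
    intro u h h' y e
    rcases hY.exists_rep y with ⟨v, rfl⟩ | ⟨w, rfl⟩
    · exact h v (by rw [hj, e])
    · exact h' w (hm (by rw [hi, hj, e]))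
  refine ⟨hZ.inl_inj.comp hY.inl_inj, hm, fun z => ?_, fun z z' => ?_,
    fun v v' h => hZ.tot_inl _ _ (hY.tot_inl _ _ h), fun x hx v => ?_, fun x x' hx hx' h => ?_⟩
  · rcases hZ.exists_rep z with ⟨y, rfl⟩ | ⟨u, rfl⟩
    · rcases hY.exists_rep y with ⟨v, rfl⟩ | ⟨w, rfl⟩
      exacts [Or.inl ⟨v, rfl⟩, Or.inr ⟨_, hi w⟩]
    · exact Or.inr ⟨_, hj u⟩
  · rw [hZ.rel_iff]
    constructor
    · rintro (⟨y, y', hr, rfl, rfl⟩ | ⟨u, u', hr, rfl, rfl⟩)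
      · rcases (hY.rel_iff y y').1 hr with ⟨v, v', hr', rfl, rfl⟩ | ⟨w, w', hr', rfl, rfl⟩
        · exact Or.inl ⟨v, v', hr', rfl, rfl⟩
        · exact Or.inr ⟨_, _, hX.rel_inl hr', hi w, hi w'⟩
      · exact Or.inr ⟨_, _, hX.rel_inr hr, hj u, hj u'⟩
    · rintro (⟨v, v', hr, rfl, rfl⟩ | ⟨x, x', hr, rfl, rfl⟩)
      · exact Or.inl ⟨_, _, hY.rel_inl hr, rfl, rfl⟩
      · rcases (hX.rel_iff x x').1 hr with ⟨w, w', hr', rfl, rfl⟩ | ⟨u, u', hr', rfl, rfl⟩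
        · exact Or.inl ⟨_, _, hY.rel_inr hr', (hi w).symm, (hi w').symm⟩
        · exact Or.inr ⟨u, u', hr', (hj u).symm, (hj u').symm⟩
  · rcases hX.exists_first x with ⟨w, rfl⟩ | ⟨u, hu', rfl⟩
    · rw [hi]
      exact hZ.tot_inl _ _ (hY.tot_inl_inr _ (hw w hx) v)
    · rw [hj]
      exact hZ.tot_inl_inr _ (hu u hx hu') _
  · rcases hX.exists_first x with ⟨w, rfl⟩ | ⟨u, hu1, rfl⟩ <;>
      rcases hX.exists_first x' with ⟨w', rfl⟩ | ⟨u', hu2, rfl⟩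
    · rw [hi, hi]
      exact hZ.tot_inl _ _ (hY.tot_inr _ _ (hw _ hx) (hw _ hx') (hX.tot_inl_iff.1 h))
    · rw [hi, hj]
      exact hZ.tot_inl_inr _ (hu u' hx' hu2) _
    · exact absurd h (hX.not_tot_inr_inl hu1 _)
    · rw [hj, hj]
      exact hZ.tot_inr _ _ (hu u hx hu1) (hu u' hx' hu2) ((hX.tot_inr_iff hu1 hu2).1 h)

/-- Reassociation of a double gluing to the left. -/
theorem assoc_left {i : G.V → Y.V} {j : H.V → Y.V} {k : Y.V → Z.V} {a : G.V → Z.V}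
    {i' : H.V → X.V} {j' : L.V → X.V} {m : X.V → Z.V} (hX : IsGluing H L X i' j')
    (hZ : IsGluing G X Z a m) (hY : IsGluing G H Y i j) (hk : Function.Injective k)
    (hi : ∀ v, k (i v) = a v) (hj : ∀ w, k (j w) = m (i' w)) :
    IsGluing Y L Z k (fun u => m (j' u)) := by
  have hw : ∀ w, (∀ v, i v ≠ j w) → ∀ v, a v ≠ m (i' w) :=
    fun w h v e => h v (hk (by rw [hi, hj, e]))
  have hu : ∀ u, (∀ y, k y ≠ m (j' u)) → ∀ v, a v ≠ m (j' u) :=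
    fun u h v e => h (i v) (by rw [hi, e])
  have hu' : ∀ u, (∀ y, k y ≠ m (j' u)) → ∀ w, i' w ≠ j' u :=
    fun u h w e => h (j w) (by rw [hj, e])
  refine ⟨hk, hZ.inr_inj.comp hX.inr_inj, fun z => ?_, fun z z' => ?_, fun y y' h => ?_,
    fun u h y => ?_, fun u u' h h' hr => hZ.tot_inr _ _ (hu u h) (hu u' h')
      (hX.tot_inr _ _ (hu' u h) (hu' u' h') hr)⟩
  · rcases hZ.exists_rep z with ⟨v, rfl⟩ | ⟨x, rfl⟩
    · exact Or.inl ⟨_, hi v⟩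
    · rcases hX.exists_rep x with ⟨w, rfl⟩ | ⟨u, rfl⟩
      exacts [Or.inl ⟨_, hj w⟩, Or.inr ⟨u, rfl⟩]
  · rw [hZ.rel_iff]
    constructor
    · rintro (⟨v, v', hr, rfl, rfl⟩ | ⟨x, x', hr, rfl, rfl⟩)
      · exact Or.inl ⟨_, _, hY.rel_inl hr, hi v, hi v'⟩
      · rcases (hX.rel_iff x x').1 hr with ⟨w, w', hr', rfl, rfl⟩ | ⟨u, u', hr', rfl, rfl⟩
        · exact Or.inl ⟨_, _, hY.rel_inr hr', hj w, hj w'⟩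
        · exact Or.inr ⟨u, u', hr', rfl, rfl⟩
    · rintro (⟨y, y', hr, rfl, rfl⟩ | ⟨u, u', hr, rfl, rfl⟩)
      · rcases (hY.rel_iff y y').1 hr with ⟨v, v', hr', rfl, rfl⟩ | ⟨w, w', hr', rfl, rfl⟩
        · exact Or.inl ⟨v, v', hr', (hi v).symm, (hi v').symm⟩
        · exact Or.inr ⟨_, _, hX.rel_inl hr', (hj w).symm, (hj w').symm⟩
      · exact Or.inr ⟨_, _, hX.rel_inr hr, rfl, rfl⟩
  · rcases hY.exists_first y with ⟨v, rfl⟩ | ⟨w, hw1, rfl⟩ <;>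
      rcases hY.exists_first y' with ⟨v', rfl⟩ | ⟨w', hw2, rfl⟩
    · rw [hi, hi]
      exact hZ.tot_inl _ _ (hY.tot_inl_iff.1 h)
    · rw [hi, hj]
      exact hZ.tot_inl_inr _ (hw _ hw2) _
    · exact absurd h (hY.not_tot_inr_inl hw1 _)
    · rw [hj, hj]
      exact hZ.tot_inr _ _ (hw _ hw1) (hw _ hw2)
        (hX.tot_inl _ _ ((hY.tot_inr_iff hw1 hw2).1 h))
  · rcases hY.exists_first y with ⟨v, rfl⟩ | ⟨w, hw1, rfl⟩
    · rw [hi]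
      exact hZ.tot_inl_inr _ (hu u h) _
    · rw [hj]
      exact hZ.tot_inr _ _ (hw _ hw1) (hu u h) (hX.tot_inl_inr _ (hu' u h) _)

end IsGluing

end OrdGraph

/-! ### Cycles -/

namespace FinRel

-- This form of a cycle contradicts antisymmetry of the path order directly.
open Fin.NatCast in
theorem HasCycle.exists_transGen {G : FinRel} (h : G.HasCycle) :
    ∃ x y, x ≠ y ∧ Relation.TransGen G.rel x y ∧ Relation.TransGen G.rel y x := by
  obtain ⟨k, c, hc, hr⟩ := h
  have step : ∀ m n : ℕ, Relation.TransGen G.rel (c (m : Fin (k + 2)))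
      (c ((m + n + 1 : ℕ) : Fin (k + 2))) := by
    intro m n
    induction n with
    | zero => simpa using Relation.TransGen.single (hr (m : Fin (k + 2)))
    | succ n ih =>
      refine ih.tail ?_
      rw [show m + (n + 1) + 1 = (m + n + 1) + 1 by omega, Nat.cast_succ (m + n + 1)]
      exact hr _
  refine ⟨c 0, c 1, fun e => by simpa using hc e, by simpa using step 0 0, ?_⟩
  -- From index `1`, the `k + 1` remaining edges lead to index `k + 2`, which is `0` modulo the
  -- length of the cycle.
  have h1 := step 1 k
  have h2 : ((1 + k + 1 : ℕ) : Fin (k + 2)) = 0 := by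
    rw [show 1 + k + 1 = k + 2 by omega, Fin.natCast_self]
  rw [h2] at h1
  simpa using h1

/-- For the converse, if there were no cycle, antisymmetry of the path order would collapse the
first edge of a closed walk to a loop. -/
theorem hasCycle_iff {G : FinRel} (hs : G.IsSimple) :
    G.HasCycle ↔ ∃ x, Relation.TransGen G.rel x x := by
  constructor
  · intro h
    obtain ⟨x, y, -, hxy, hyx⟩ := h.exists_transGen
    exact ⟨x, hxy.trans hyx⟩
  · rintro ⟨x, hx⟩
    by_contra hc
    have hp := pathOrder_isPoset hs hc
    obtain ⟨y, hxy, hyx⟩ := Relation.TransGen.head'_iff.1 hx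
    have e := hp.antisymm x y (Relation.ReflTransGen.single hxy) hyx
    rw [← e] at hxy
    exact hs _ hxy

theorem HasCycle.map {G H : FinRel} {f : G.V → H.V} (hf : Function.Injective f)
    (hr : ∀ x y, G.rel x y → H.rel (f x) (f y)) (h : G.HasCycle) : H.HasCycle := by
  obtain ⟨k, c, hc, h⟩ := h
  exact ⟨k, f ∘ c, hf.comp hc, fun i => hr _ _ (h i)⟩

/-- A walk that enters an ideal never leaves it, so a closed walk lies entirely inside the ideal or
entirely outside. -/
theorem HasCycle.restrict_or {G : FinRel} (hs : G.IsSimple) {A : Set G.V} (hA : G.IsIdeal A)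
    (h : G.HasCycle) : (G.restrict Aᶜ).HasCycle ∨ (G.restrict A).HasCycle := by
  obtain ⟨x, hx⟩ := (hasCycle_iff hs).1 h
  by_cases hxA : x ∈ A
  · refine Or.inr ((hasCycle_iff (hs.restrict A)).2 ⟨⟨x, hxA⟩, ?_⟩)
    have key : ∀ y, Relation.TransGen G.rel x y →
        ∃ hy : y ∈ A, Relation.TransGen (G.restrict A).rel ⟨x, hxA⟩ ⟨y, hy⟩ := by
      intro y hy
      induction hy with
      | single h => exact ⟨hA _ _ hxA h, Relation.TransGen.single h⟩
      | tail _ h ih => exact ⟨hA _ _ ih.1 h, ih.2.tail h⟩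
    exact (key x hx).2
  · refine Or.inl ((hasCycle_iff (hs.restrict Aᶜ)).2 ⟨⟨x, hxA⟩, ?_⟩)
    have key : ∀ y, Relation.TransGen G.rel x y → (hy : y ∉ A) →
        Relation.TransGen (G.restrict Aᶜ).rel ⟨x, hxA⟩ ⟨y, hy⟩ := by
      intro y hy
      induction hy with
      | single h => exact fun _ => Relation.TransGen.single h
      | tail _ h ih => exact fun hy => (ih fun hb => hy (hA _ _ hb h)).tail h
    exact key x hx hxA

end FinRel

/-! ### Products and coproducts of ordered graphs -/

/-- The underlying ordered graph. -/
def OrdAcyclicGraph.toOrdGraph (G : OrdAcyclicGraph) : OrdGraph where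
  toFinRel := G.toFinRel
  isSimple := G.isSimple
  tot := G.tot
  isLinearOrder := G.isLinearOrder

namespace OrdGraph

variable (K : Type u) [Field K]

open Classical in
/-- The basis element attached to an ordered graph if it has no cycle, and zero otherwise. -/
noncomputable def dagElt (G : OrdGraph) : HOrdGraph K :=
  if h : ¬ G.HasCycle then
    OrdAcyclicGraph.elt K ⟨⟨G.toFinRel, G.isSimple, h⟩, G.tot, G.isLinearOrder⟩
  else 0

/-- The sum over all gluings that have no cycle. -/
noncomputable def prodSum {K : Type u} [Field K] (q : K) (G H : OrdGraph) : HOrdGraph K :=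
  ∑ σ : PartialInj G.V H.V, q ^ σ.card • (G.glue H σ).dagElt K

open Classical in
/-- The sum over all ideals. -/
noncomputable def copSum (G : OrdGraph) : HOrdGraph K ⊗[K] HOrdGraph K :=
  ∑ A : {A : Set G.V // G.IsIdeal A}, (G.restrict A.1ᶜ).dagElt K ⊗ₜ[K] (G.restrict A.1).dagElt K

variable {K}

theorem dagElt_of_hasCycle {G : OrdGraph} (h : G.HasCycle) : G.dagElt K = 0 :=
  dif_neg (not_not.2 h)

theorem dagElt_toOrdGraph (G : OrdAcyclicGraph) : G.toOrdGraph.dagElt K = G.elt K :=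
  dif_pos G.acyclic

theorem hasCycle_or_exists (G : OrdGraph) :
    G.HasCycle ∨ ∃ X : OrdAcyclicGraph, X.toOrdGraph = G := by
  by_cases h : G.HasCycle
  · exact Or.inl h
  · exact Or.inr ⟨⟨⟨G.toFinRel, G.isSimple, h⟩, G.tot, G.isLinearOrder⟩, rfl⟩

theorem dagElt_congr {G H : OrdGraph} {f : G.V → H.V} (hf : IsEmb f)
    (hs : Function.Surjective f) : G.dagElt K = H.dagElt K := by
  let e := Equiv.ofBijective f ⟨hf.inj, hs⟩
  have hc : G.HasCycle ↔ H.HasCycle :=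
    ⟨FinRel.HasCycle.map hf.inj fun x y => (hf.rel_iff x y).2,
      FinRel.HasCycle.map e.symm.injective fun x y hr => by
        rw [← hf.rel_iff]
        change H.rel (e (e.symm x)) (e (e.symm y))
        rwa [e.apply_symm_apply, e.apply_symm_apply]⟩
  by_cases h : G.HasCycle
  · rw [dagElt_of_hasCycle h, dagElt_of_hasCycle (hc.1 h)]
  · rw [dagElt, dif_pos h, dagElt, dif_pos (mt hc.2 h)]
    refine congrArg (Finsupp.single · 1) (Quotient.sound ?_)
    exact ⟨⟨e, fun {x y} => hf.rel_iff x y⟩, hf.tot_iff⟩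

theorem hasCycle_glue_left {G : OrdGraph} (H : OrdGraph) (σ : PartialInj G.V H.V)
    (h : G.HasCycle) : (G.glue H σ).HasCycle :=
  h.map (G.glue_isGluing H σ).inl_inj fun _ _ => (G.glue_isGluing H σ).rel_inl

theorem hasCycle_glue_right (G : OrdGraph) {H : OrdGraph} (σ : PartialInj G.V H.V)
    (h : H.HasCycle) : (G.glue H σ).HasCycle :=
  h.map (G.glue_isGluing H σ).inr_inj fun _ _ => (G.glue_isGluing H σ).rel_inr

theorem prodSum_left_of_hasCycle (q : K) {G : OrdGraph} (H : OrdGraph) (h : G.HasCycle) :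
    prodSum q G H = 0 :=
  Finset.sum_eq_zero fun σ _ => by
    rw [dagElt_of_hasCycle (hasCycle_glue_left H σ h), smul_zero]

theorem prodSum_right_of_hasCycle (q : K) (G : OrdGraph) {H : OrdGraph} (h : H.HasCycle) :
    prodSum q G H = 0 :=
  Finset.sum_eq_zero fun σ _ => by
    rw [dagElt_of_hasCycle (hasCycle_glue_right G σ h), smul_zero]

/-- In every term, one of the two tensor factors still has a cycle. With the vanishing of `prodSum`
on graphs with cycles, this makes it consistent to count such graphs as zero. -/
theorem copSum_of_hasCycle {G : OrdGraph} (h : G.HasCycle) : copSum K G = 0 :=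
  Finset.sum_eq_zero fun A _ => by
    rcases h.restrict_or G.isSimple A.2 with h | h
    · rw [dagElt_of_hasCycle (G := G.restrict A.1ᶜ) h, TensorProduct.zero_tmul]
    · rw [dagElt_of_hasCycle (G := G.restrict A.1) h, TensorProduct.tmul_zero]

theorem prodSum_toOrdGraph (q : K) (G H : OrdAcyclicGraph) :
    prodSum q G.toOrdGraph H.toOrdGraph = G.product q H := by
  symm
  refine Finset.sum_of_injOn Subtype.val Subtype.val_injective.injOn
    (fun _ _ => Finset.mem_coe.2 (Finset.mem_univ _)) ?_ ?_
  · intro σ _ hσ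
    have : (G.toOrdGraph.glue H.toOrdGraph σ).HasCycle := by
      by_contra h
      exact hσ ⟨⟨σ, h⟩, by simp, rfl⟩
    rw [dagElt_of_hasCycle this, smul_zero]
  · intro σ _
    refine congrArg (q ^ σ.1.card • ·) (Eq.symm ?_)
    exact dif_pos (c := ¬ (G.toOrdGraph.glue H.toOrdGraph σ.1).HasCycle) σ.2

theorem copSum_toOrdGraph (G : OrdAcyclicGraph) : copSum K G.toOrdGraph = G.coproduct K :=
  Finset.sum_congr rfl fun A _ => congrArg₂ (· ⊗ₜ[K] ·)
    (dagElt_toOrdGraph (G.restrict A.1ᶜ)) (dagElt_toOrdGraph (G.restrict A.1))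

/-- With `IsGluing.card_add_card`, this evaluates a term of the product from any model of the
gluing, without constructing an isomorphism by hand. -/
theorem IsGluing.dagElt_eq {G H Z : OrdGraph} {i : G.V → Z.V} {j : H.V → Z.V}
    (h : IsGluing G H Z i j) {σ : PartialInj G.V H.V}
    (hσ : ∀ v w, G.glueInl H σ v = G.glueInr H σ w ↔ i v = j w) :
    (G.glue H σ).dagElt K = Z.dagElt K := by
  obtain ⟨e, hs, he, -⟩ := (G.glue_isGluing H σ).exists_iso h hσ
  exact dagElt_congr he hs

theorem IsGluing.card_add_card {G H Z : OrdGraph} {i : G.V → Z.V} {j : H.V → Z.V}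
    (h : IsGluing G H Z i j) {σ : PartialInj G.V H.V}
    (hσ : ∀ v w, G.glueInl H σ v = G.glueInr H σ w ↔ i v = j w) :
    Nat.card G.V + Nat.card H.V = Nat.card Z.V + σ.card := by
  obtain ⟨e, hs, he, -⟩ := (G.glue_isGluing H σ).exists_iso h hσ
  rw [σ.card_add_card, ← Nat.card_eq_of_bijective e ⟨he.inj, hs⟩]
  rfl

theorem IsGluing.comp_iso {G H G' H' Z : OrdGraph} {i : G'.V → Z.V} {j : H'.V → Z.V}
    (h : IsGluing G' H' Z i j) {f : G.V → G'.V} {g : H.V → H'.V} (hf : IsEmb f)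
    (hfs : Function.Surjective f) (hg : IsEmb g) (hgs : Function.Surjective g) :
    IsGluing G H Z (fun v => i (f v)) (fun w => j (g w)) where
  inl_inj := h.inl_inj.comp hf.inj
  inr_inj := h.inr_inj.comp hg.inj
  exists_rep z := by
    simpa only [hfs.exists, hgs.exists] using h.exists_rep z
  rel_iff z z' := by
    simpa only [hfs.exists, hgs.exists, hf.rel_iff, hg.rel_iff] using h.rel_iff z z'
  tot_inl v v' hv := h.tot_inl _ _ ((hf.tot_iff _ _).2 hv)
  tot_inl_inr w hw v := h.tot_inl_inr _ (hfs.forall.2 hw) _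
  tot_inr w w' hw hw' hr :=
    h.tot_inr _ _ (hfs.forall.2 hw) (hfs.forall.2 hw') ((hg.tot_iff _ _).2 hr)

/-- Partial injections are matched when they make the same identifications through `f` and `g`; the
graph and the exponent then agree because both belong to one gluing. -/
theorem prodSum_congr (q : K) {G H G' H' : OrdGraph} {f : G.V → G'.V} {g : H.V → H'.V}
    (hf : IsEmb f) (hfs : Function.Surjective f) (hg : IsEmb g) (hgs : Function.Surjective g) :
    prodSum q G H = prodSum q G' H' := by
  refine sum_eq_sum_of_rel (fun σ τ => ∀ v w, G.glueInl H σ v = G.glueInr H σ w ↔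
      G'.glueInl H' τ (f v) = G'.glueInr H' τ (g w))
    (fun σ => ?_) (fun τ => ?_) (fun σ τ τ' h h' => partialInj_ext ?_)
    (fun σ σ' τ h h' => partialInj_ext fun v w => (h v w).trans (h' v w).symm)
    (fun σ τ h => ?_)
  · let e := Equiv.ofBijective f ⟨hf.inj, hfs⟩
    let e' := Equiv.ofBijective g ⟨hg.inj, hgs⟩
    obtain ⟨τ, hτ⟩ := exists_partialInj
      ((G.glue_isGluing H σ).inl_inj.comp e.symm.injective)
      ((G.glue_isGluing H σ).inr_inj.comp e'.symm.injective)
    refine ⟨τ, fun v w => ?_⟩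
    have := (hτ (e v) (e' w)).symm
    simp only [Function.comp_apply, Equiv.symm_apply_apply] at this
    exact this
  · have hZ := (G'.glue_isGluing H' τ).comp_iso hf hfs hg hgs
    exact exists_partialInj hZ.inl_inj hZ.inr_inj
  · exact hfs.forall.2 fun v => hgs.forall.2 fun w => (h v w).symm.trans (h' v w)
  · have hZ := (G'.glue_isGluing H' τ).comp_iso hf hfs hg hgs
    have h1 := hZ.card_add_card h
    have h2 := (G.glue_isGluing H σ).card_add_card fun _ _ => Iff.rfl
    have h3 := (G'.glue_isGluing H' τ).card_add_card fun _ _ => Iff.rfl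
    rw [Nat.card_eq_of_bijective f ⟨hf.inj, hfs⟩, Nat.card_eq_of_bijective g ⟨hg.inj, hgs⟩] at h1
    rw [hZ.dagElt_eq h, show σ.card = τ.card by omega]

theorem dagElt_restrict_restrict (G : OrdGraph) (A : Set G.V) (B : Set (G.restrict A).V) :
    ((G.restrict A).restrict B).dagElt K = (G.restrict {x | ∃ h : x ∈ A, ⟨x, h⟩ ∈ B}).dagElt K :=
  dagElt_congr (f := fun x => ⟨x.1.1, x.1.2, x.2⟩)
    ⟨fun _ _ h => Subtype.ext (Subtype.ext (Subtype.mk.inj h)), fun _ _ => Iff.rfl,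
      fun _ _ => Iff.rfl⟩
    fun ⟨x, h, h'⟩ => ⟨⟨⟨x, h⟩, h'⟩, rfl⟩

open Classical in
theorem copSum_congr {G H : OrdGraph} {f : G.V → H.V} (hf : IsEmb f)
    (hs : Function.Surjective f) : copSum K G = copSum K H := by
  have emb : ∀ B : Set H.V, (G.restrict (f ⁻¹' B)).dagElt K = (H.restrict B).dagElt K := fun B =>
    dagElt_congr (f := fun x => ⟨f x.1, x.2⟩)
      ⟨fun x y h => Subtype.ext (hf.inj (congrArg Subtype.val h)), fun _ _ => hf.rel_iff _ _,
        fun _ _ => hf.tot_iff _ _⟩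
      fun ⟨y, hy⟩ => by
        obtain ⟨x, rfl⟩ := hs y
        exact ⟨⟨x, hy⟩, rfl⟩
  refine sum_eq_sum_of_rel
    (fun (A : {A : Set G.V // G.IsIdeal A}) (B : {B : Set H.V // H.IsIdeal B}) => A.1 = f ⁻¹' B.1)
    (fun A => ?_) (fun B => ?_)
    (fun A B B' h h' => Subtype.ext (hs.preimage_injective (h.symm.trans h')))
    (fun A A' B h h' => Subtype.ext (h.trans h'.symm)) (fun A B h => ?_)
  · refine ⟨⟨f '' A.1, ?_⟩, (hf.inj.preimage_image _).symm⟩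
    rintro _ y ⟨x, hx, rfl⟩ hr
    obtain ⟨y, rfl⟩ := hs y
    exact ⟨y, A.2 _ _ hx ((hf.rel_iff _ _).1 hr), rfl⟩
  · exact ⟨⟨f ⁻¹' B.1, fun x y hx hr => B.2 _ _ hx ((hf.rel_iff _ _).2 hr)⟩, rfl⟩
  · rw [h, ← emb, ← emb, Set.preimage_compl]

end OrdGraph

namespace OrdGraph

variable {K : Type u} [Field K]

/-! ### Associativity -/

/-- Two double gluings are matched when they are isomorphic compatibly with the maps from `G`, `H`
and `L`. No acyclicity of the intermediate gluing has to be tracked, since only the final graph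
carries a weight. -/
theorem sum_glue_assoc (q : K) (G H L : OrdGraph) :
    ∑ σ : PartialInj G.V H.V, q ^ σ.card • prodSum q (G.glue H σ) L =
      ∑ τ : PartialInj H.V L.V, q ^ τ.card • prodSum q G (H.glue L τ) := by
  simp only [prodSum, Finset.smul_sum, smul_smul, ← pow_add]
  rw [← Fintype.sum_sigma', ← Fintype.sum_sigma']
  refine sum_eq_sum_of_rel
    (fun (s : Σ σ : PartialInj G.V H.V, PartialInj (G.glue H σ).V L.V)
      (t : Σ τ : PartialInj H.V L.V, PartialInj G.V (H.glue L τ).V) =>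
      ∃ e : ((G.glue H s.1).glue L s.2).V → (G.glue (H.glue L t.1) t.2).V,
        Function.Surjective e ∧ IsEmb e ∧
        (∀ v, e ((G.glue H s.1).glueInl L s.2 (G.glueInl H s.1 v)) =
          G.glueInl (H.glue L t.1) t.2 v) ∧
        (∀ w, e ((G.glue H s.1).glueInl L s.2 (G.glueInr H s.1 w)) =
          G.glueInr (H.glue L t.1) t.2 (H.glueInl L t.1 w)) ∧
        ∀ x, e ((G.glue H s.1).glueInr L s.2 x) =
          G.glueInr (H.glue L t.1) t.2 (H.glueInr L t.1 x))
    ?_ ?_ ?_ ?_ ?_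
  · rintro ⟨σ, τ⟩
    have hY := G.glue_isGluing H σ
    have hZ := (G.glue H σ).glue_isGluing L τ
    -- `τ'` records the coincidences of `H` and `L` inside the triple gluing. The gluing of `H` and
    -- `L` then embeds there, and its coincidences with `G` give `σ'`.
    obtain ⟨τ', hτ'⟩ := exists_partialInj (hZ.inl_inj.comp hY.inr_inj) hZ.inr_inj
    have hX := H.glue_isGluing L τ'
    obtain ⟨m, hm, hm1, hm2⟩ := hX.exists_map (hZ.inl_inj.comp hY.inr_inj) hZ.inr_inj hτ'
    have hA := hY.assoc_right hZ hX hm hm1 hm2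
    obtain ⟨σ', hσ'⟩ := exists_partialInj hA.inl_inj hA.inr_inj
    obtain ⟨e, he, he', h1, h2⟩ :=
      hA.exists_iso (G.glue_isGluing (H.glue L τ') σ') fun v x => (hσ' v x).symm
    exact ⟨⟨τ', σ'⟩, e, he, he', h1, fun w => (congrArg e (hm1 w)).symm.trans (h2 _),
      fun x => (congrArg e (hm2 x)).symm.trans (h2 _)⟩
  · rintro ⟨τ', σ'⟩
    have hX := H.glue_isGluing L τ'
    have hZ := G.glue_isGluing (H.glue L τ') σ'
    obtain ⟨σ, hσ⟩ := exists_partialInj hZ.inl_inj (hZ.inr_inj.comp hX.inl_inj)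
    have hY := G.glue_isGluing H σ
    obtain ⟨k, hk, hk1, hk2⟩ := hY.exists_map hZ.inl_inj (hZ.inr_inj.comp hX.inl_inj) hσ
    have hA := hX.assoc_left hZ hY hk hk1 hk2
    obtain ⟨τ, hτ⟩ := exists_partialInj hA.inl_inj hA.inr_inj
    obtain ⟨e, he, he', h1, h2⟩ := ((G.glue H σ).glue_isGluing L τ).exists_iso hA hτ
    exact ⟨⟨σ, τ⟩, e, he, he', fun v => (h1 _).trans (hk1 v),
      fun w => (h1 _).trans (hk2 w), h2⟩
  · rintro ⟨σ, τ⟩ ⟨τ1, σ1⟩ ⟨τ2, σ2⟩ ⟨e, he, he', h1, h2, h3⟩ ⟨f, hf, hf', g1, g2, g3⟩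
    -- Both partial injections record coincidences already decided in the triple gluing on the left.
    obtain rfl : τ1 = τ2 := partialInj_ext fun w x => by
      rw [← (G.glue_isGluing (H.glue L τ1) σ1).inr_inj.eq_iff,
        ← (G.glue_isGluing (H.glue L τ2) σ2).inr_inj.eq_iff]
      dsimp only at h2 h3 g2 g3
      rw [← h2, ← h3, ← g2, ← g3, he'.inj.eq_iff, hf'.inj.eq_iff]
    obtain rfl : σ1 = σ2 := partialInj_ext fun v y => by
      dsimp only at h1 h2 h3 g1 g2 g3
      rcases (H.glue_isGluing L τ1).exists_rep y with ⟨w, rfl⟩ | ⟨x, rfl⟩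
      · rw [← h1, ← h2, ← g1, ← g2, he'.inj.eq_iff, hf'.inj.eq_iff]
      · rw [← h1, ← h3, ← g1, ← g3, he'.inj.eq_iff, hf'.inj.eq_iff]
    rfl
  · rintro ⟨σ1, τ1⟩ ⟨σ2, τ2⟩ ⟨τ', σ'⟩ ⟨e, he, he', h1, h2, h3⟩ ⟨f, hf, hf', g1, g2, g3⟩
    obtain rfl : σ1 = σ2 := partialInj_ext fun v w => by
      rw [← ((G.glue H σ1).glue_isGluing L τ1).inl_inj.eq_iff,
        ← ((G.glue H σ2).glue_isGluing L τ2).inl_inj.eq_iff]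
      dsimp only at h1 h2 g1 g2
      rw [← he'.inj.eq_iff, h1, h2, ← g1, ← g2, hf'.inj.eq_iff]
    obtain rfl : τ1 = τ2 := partialInj_ext fun y x => by
      dsimp only at h1 h2 h3 g1 g2 g3
      rcases (G.glue_isGluing H σ1).exists_rep y with ⟨v, rfl⟩ | ⟨w, rfl⟩
      · rw [← he'.inj.eq_iff, h1, h3, ← g1, ← g3, hf'.inj.eq_iff]
      · rw [← he'.inj.eq_iff, h2, h3, ← g2, ← g3, hf'.inj.eq_iff]
    rfl
  · rintro ⟨σ, τ⟩ ⟨τ', σ'⟩ ⟨e, he, he', -⟩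
    -- Both total exponents equal the number of vertices of the three graphs minus that of the
    -- triple gluing.
    have h1 := (G.glue_isGluing H σ).card_add_card fun _ _ => Iff.rfl
    have h2 := ((G.glue H σ).glue_isGluing L τ).card_add_card fun _ _ => Iff.rfl
    have h3 := (H.glue_isGluing L τ').card_add_card fun _ _ => Iff.rfl
    have h4 := (G.glue_isGluing (H.glue L τ') σ').card_add_card fun _ _ => Iff.rfl
    have h5 := Nat.card_eq_of_bijective e ⟨he'.inj, he⟩
    dsimp only at h5 ⊢
    rw [dagElt_congr he' he, show σ.card + τ.card = τ'.card + σ'.card by omega]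

/-! ### Compatibility of the product and the coproduct -/

-- An ideal `C` of a gluing corresponds to ideals `A` and `B` of the factors, together with one
-- partial injection inside `A` and `B` and another between their complements. Restricting a gluing
-- is gluing the restrictions, so the terms agree.
open Classical in
theorem sum_copSum_glue (q : K) (G H : OrdGraph) :
    ∑ σ : PartialInj G.V H.V, q ^ σ.card • copSum K (G.glue H σ) =
      ∑ A : {A : Set G.V // G.IsIdeal A}, ∑ B : {B : Set H.V // H.IsIdeal B},
        prodSum q (G.restrict A.1ᶜ) (H.restrict B.1ᶜ) ⊗ₜ[K]
          prodSum q (G.restrict A.1) (H.restrict B.1) := by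
  simp only [prodSum, copSum, TensorProduct.sum_tmul, TensorProduct.tmul_sum, Finset.smul_sum,
    TensorProduct.smul_tmul_smul, ← pow_add]
  simp only [← Fintype.sum_sigma']
  refine sum_eq_sum_of_rel
    (fun (s : Σ σ : PartialInj G.V H.V, {C : Set (G.glue H σ).V // (G.glue H σ).IsIdeal C})
      (t : Σ A : {A : Set G.V // G.IsIdeal A}, Σ B : {B : Set H.V // H.IsIdeal B},
        Σ _ : PartialInj (G.restrict A.1).V (H.restrict B.1).V,
          PartialInj (G.restrict A.1ᶜ).V (H.restrict B.1ᶜ).V) =>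
      t.1.1 = G.glueInl H s.1 ⁻¹' s.2.1 ∧ t.2.1.1 = G.glueInr H s.1 ⁻¹' s.2.1 ∧
      (∀ v w, (G.restrict t.1.1).glueInl (H.restrict t.2.1.1) t.2.2.1 v =
        (G.restrict t.1.1).glueInr (H.restrict t.2.1.1) t.2.2.1 w ↔
        G.glueInl H s.1 v.1 = G.glueInr H s.1 w.1) ∧
      ∀ v w, (G.restrict t.1.1ᶜ).glueInl (H.restrict t.2.1.1ᶜ) t.2.2.2 v =
        (G.restrict t.1.1ᶜ).glueInr (H.restrict t.2.1.1ᶜ) t.2.2.2 w ↔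
        G.glueInl H s.1 v.1 = G.glueInr H s.1 w.1)
    ?_ ?_ ?_ ?_ ?_
  · rintro ⟨σ, C, hC⟩
    have hZ := G.glue_isGluing H σ
    obtain ⟨τ, hτ⟩ := exists_partialInj (hZ.restrict C).inl_inj (hZ.restrict C).inr_inj
    obtain ⟨τ', hτ'⟩ := exists_partialInj (hZ.restrict Cᶜ).inl_inj (hZ.restrict Cᶜ).inr_inj
    exact ⟨⟨⟨_, fun v v' hv hr => hC _ _ hv (hZ.rel_inl hr)⟩,
      ⟨_, fun w w' hw hr => hC _ _ hw (hZ.rel_inr hr)⟩, τ, τ'⟩, rfl, rfl,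
      fun v w => (hτ v w).trans Subtype.ext_iff, fun v w => (hτ' v w).trans Subtype.ext_iff⟩
  · rintro ⟨⟨A, hA⟩, ⟨B, hB⟩, τ, τ'⟩
    -- Both factors are mapped into the disjoint union of the two small gluings; `σ` is the pattern
    -- of coincidences there, which cannot mix the two summands.
    let a : G.V → Glued τ ⊕ Glued τ' := fun v =>
      if h : v ∈ A then Sum.inl (Glued.mk τ (Sum.inl ⟨v, h⟩))
      else Sum.inr (Glued.mk τ' (Sum.inl ⟨v, h⟩))
    let b : H.V → Glued τ ⊕ Glued τ' := fun w =>
      if h : w ∈ B then Sum.inl (Glued.mk τ (Sum.inr ⟨w, h⟩))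
      else Sum.inr (Glued.mk τ' (Sum.inr ⟨w, h⟩))
    have ha : Function.Injective a := by
      intro v v' h
      simp only [a] at h
      split_ifs at h
      · exact congrArg Subtype.val (Glued.inl_injective _ (Sum.inl.inj h))
      · exact congrArg Subtype.val (Glued.inl_injective _ (Sum.inr.inj h))
    have hb : Function.Injective b := by
      intro v v' h
      simp only [b] at h
      split_ifs at h
      · exact congrArg Subtype.val (Glued.inr_injective _ (Sum.inl.inj h))
      · exact congrArg Subtype.val (Glued.inr_injective _ (Sum.inr.inj h))
    have hab : ∀ v w, a v = b w → (v ∈ A ↔ w ∈ B) := by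
      intro v w h
      simp only [a, b] at h
      split_ifs at h with h1 h2 h2
      · exact iff_of_true h1 h2
      · exact iff_of_false h1 h2
    obtain ⟨σ, hσ⟩ := exists_partialInj ha hb
    let C : Set (G.glue H σ).V := {z | (∃ v ∈ A, G.glueInl H σ v = z) ∨
      ∃ w ∈ B, G.glueInr H σ w = z}
    have hCA : ∀ v, G.glueInl H σ v ∈ C ↔ v ∈ A := by
      refine fun v => ⟨?_, fun hv => Or.inl ⟨v, hv, rfl⟩⟩
      rintro (⟨v', hv', e⟩ | ⟨w, hw, e⟩)
      · rwa [← (G.glue_isGluing H σ).inl_inj e]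
      · exact (hab v w ((hσ v w).1 e.symm)).2 hw
    have hCB : ∀ w, G.glueInr H σ w ∈ C ↔ w ∈ B := by
      refine fun w => ⟨?_, fun hw => Or.inr ⟨w, hw, rfl⟩⟩
      rintro (⟨v, hv, e⟩ | ⟨w', hw', e⟩)
      · exact (hab v w ((hσ v w).1 e)).1 hv
      · rwa [← (G.glue_isGluing H σ).inr_inj e]
    refine ⟨⟨σ, C, ?_⟩, Set.ext fun v => (hCA v).symm, Set.ext fun w => (hCB w).symm,
      fun v w => ?_, fun v w => ?_⟩
    · intro z z' hz hr
      rcases ((G.glue_isGluing H σ).rel_iff z z').1 hr with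
        ⟨v, v', hr', rfl, rfl⟩ | ⟨w, w', hr', rfl, rfl⟩
      · exact (hCA v').2 (hA _ _ ((hCA v).1 hz) hr')
      · exact (hCB w').2 (hB _ _ ((hCB w).1 hz) hr')
    · refine Iff.trans ?_ (hσ v.1 w.1).symm
      simp only [a, b, dif_pos v.2, dif_pos w.2, Sum.inl.injEq]
      exact Iff.rfl
    · refine Iff.trans ?_ (hσ v.1 w.1).symm
      simp only [a, b, dif_neg v.2, dif_neg w.2, Sum.inr.injEq]
      exact Iff.rfl
  · rintro ⟨σ, C, hC⟩ ⟨⟨A, hA⟩, ⟨B, hB⟩, τ, τ'⟩ ⟨⟨A1, hA1⟩, ⟨B1, hB1⟩, τ1, τ1'⟩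
      ⟨h1, h2, h3, h4⟩ ⟨g1, g2, g3, g4⟩
    dsimp only at h1 h2 g1 g2
    subst h1 h2 g1 g2
    obtain rfl : τ = τ1 := partialInj_ext fun v w => (h3 v w).trans (g3 v w).symm
    obtain rfl : τ' = τ1' := partialInj_ext fun v w => (h4 v w).trans (g4 v w).symm
    rfl
  · rintro ⟨σ, C, hC⟩ ⟨σ1, C1, hC1⟩ ⟨⟨A, hA⟩, ⟨B, hB⟩, τ, τ'⟩ ⟨h1, h2, h3, h4⟩ ⟨g1, g2, g3, g4⟩
    dsimp only at h1 h2 g1 g2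
    -- Identified vertices are the same point of the gluing, hence both belong to `C` or neither
    -- does. Outside the two diagonal cases, `σ` therefore identifies nothing.
    have mixed : ∀ (σ : PartialInj G.V H.V) (C : Set (G.glue H σ).V),
        A = G.glueInl H σ ⁻¹' C → B = G.glueInr H σ ⁻¹' C → ∀ v w,
        G.glueInl H σ v = G.glueInr H σ w → (v ∈ A ↔ w ∈ B) := by
      rintro σ C rfl rfl v w e
      simp only [Set.mem_preimage, e]
    obtain rfl : σ = σ1 := partialInj_ext fun v w => by
      by_cases hv : v ∈ A <;> by_cases hw : w ∈ B
      · exact (h3 ⟨v, hv⟩ ⟨w, hw⟩).symm.trans (g3 ⟨v, hv⟩ ⟨w, hw⟩)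
      · exact iff_of_false (fun e => hw ((mixed σ C h1 h2 v w e).1 hv))
          (fun e => hw ((mixed σ1 C1 g1 g2 v w e).1 hv))
      · exact iff_of_false (fun e => hv ((mixed σ C h1 h2 v w e).2 hw))
          (fun e => hv ((mixed σ1 C1 g1 g2 v w e).2 hw))
      · exact (h4 ⟨v, hv⟩ ⟨w, hw⟩).symm.trans (g4 ⟨v, hv⟩ ⟨w, hw⟩)
    obtain rfl : C = C1 := Set.ext fun z => by
      rcases (G.glue_isGluing H σ).exists_rep z with ⟨v, rfl⟩ | ⟨w, rfl⟩
      · exact Set.ext_iff.1 (h1.symm.trans g1) v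
      · exact Set.ext_iff.1 (h2.symm.trans g2) w
    rfl
  · rintro ⟨σ, C, hC⟩ ⟨⟨A, hA⟩, ⟨B, hB⟩, τ, τ'⟩ ⟨h1, h2, h3, h4⟩
    dsimp only at h1 h2
    subst h1 h2
    have hZ := G.glue_isGluing H σ
    have e3 := fun v w => (h3 v w).trans (Subtype.ext_iff (p := (· ∈ C))
      (a1 := ⟨_, v.2⟩) (a2 := ⟨_, w.2⟩)).symm
    have e4 := fun v w => (h4 v w).trans (Subtype.ext_iff (p := (· ∈ Cᶜ))
      (a1 := ⟨_, v.2⟩) (a2 := ⟨_, w.2⟩)).symm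
    -- Vertex counts over `C` and over its complement add up to those of the whole gluing, so the
    -- numbers of identifications add up as well.
    have k1 := (hZ.restrict C).card_add_card e3
    have k2 := (hZ.restrict Cᶜ).card_add_card e4
    have k3 := hZ.card_add_card (σ := σ) fun _ _ => Iff.rfl
    have compl : ∀ {α : Type} [Fintype α] (S : Set α),
        Nat.card S + Nat.card (Sᶜ : Set α) = Nat.card α := fun S =>
      Set.ncard_add_ncard_compl S
    have c1 := compl (G.glueInl H σ ⁻¹' C)
    have c2 := compl (G.glueInr H σ ⁻¹' C)
    have c3 := compl C
    have hcard : σ.card = τ'.card + τ.card := by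
      change Nat.card (G.glueInl H σ ⁻¹' C) +
        Nat.card (G.glueInr H σ ⁻¹' C) = Nat.card C + τ.card at k1
      change Nat.card ((G.glueInl H σ ⁻¹' C)ᶜ : Set _) +
        Nat.card ((G.glueInr H σ ⁻¹' C)ᶜ : Set _) =
          Nat.card (Cᶜ : Set _) + τ'.card at k2
      omega
    dsimp only
    rw [hcard]
    congr 2
    · exact ((hZ.restrict Cᶜ).dagElt_eq e4).symm
    · exact ((hZ.restrict C).dagElt_eq e3).symm

/-! ### Coassociativity -/

-- Both sides run over nested ideals `A ⊆ C`, with term `G|Cᶜ ⊗ G|(C \ A) ⊗ G|A`. On the left, `C`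
-- is `A` together with an ideal of its complement; on the right, `A` is an ideal of the restriction
-- to `C`.
open Classical in
theorem sum_copSum_restrict (G : OrdGraph) :
    ∑ A : {A : Set G.V // G.IsIdeal A},
        TensorProduct.assoc K _ _ _ (copSum K (G.restrict A.1ᶜ) ⊗ₜ[K] (G.restrict A.1).dagElt K) =
      ∑ A : {A : Set G.V // G.IsIdeal A},
        (G.restrict A.1ᶜ).dagElt K ⊗ₜ[K] copSum K (G.restrict A.1) := by
  simp only [copSum, TensorProduct.sum_tmul, TensorProduct.tmul_sum, map_sum,
    TensorProduct.assoc_tmul]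
  rw [← Fintype.sum_sigma', ← Fintype.sum_sigma']
  refine sum_eq_sum_of_rel
    (fun (s : Σ A : {A : Set G.V // G.IsIdeal A},
        {B : Set (G.restrict A.1ᶜ).V // (G.restrict A.1ᶜ).IsIdeal B})
      (t : Σ A : {A : Set G.V // G.IsIdeal A},
        {B : Set (G.restrict A.1).V // (G.restrict A.1).IsIdeal B}) =>
      (∀ x, x ∈ s.1.1 ↔ ∃ h : x ∈ t.1.1, ⟨x, h⟩ ∈ t.2.1) ∧
      ∀ x, x ∈ t.1.1 ↔ x ∈ s.1.1 ∨ ∃ h : x ∈ s.1.1ᶜ, ⟨x, h⟩ ∈ s.2.1)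
    ?_ ?_ ?_ ?_ ?_
  · rintro ⟨⟨A, hA⟩, ⟨B, hB⟩⟩
    refine ⟨⟨⟨{x | x ∈ A ∨ ∃ h : x ∈ Aᶜ, ⟨x, h⟩ ∈ B}, ?_⟩, ⟨{x | x.1 ∈ A}, ?_⟩⟩,
      fun x => ⟨fun h => ⟨Or.inl h, h⟩, fun h => h.2⟩, fun x => Iff.rfl⟩
    · rintro x y (hx | ⟨hx, hx'⟩) hr
      · exact Or.inl (hA _ _ hx hr)
      · by_cases hy : y ∈ A
        · exact Or.inl hy
        · exact Or.inr ⟨hy, hB ⟨x, hx⟩ ⟨y, hy⟩ hx' hr⟩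
    · exact fun x y hx hr => hA _ _ hx hr
  · rintro ⟨⟨A, hA⟩, ⟨B, hB⟩⟩
    refine ⟨⟨⟨{x | ∃ h : x ∈ A, ⟨x, h⟩ ∈ B}, ?_⟩, ⟨{x | x.1 ∈ A}, ?_⟩⟩, fun x => Iff.rfl,
      fun x => ⟨fun h => ?_, fun h => ?_⟩⟩
    · rintro x y ⟨hx, hx'⟩ hr
      exact ⟨hA _ _ hx hr, hB ⟨x, hx⟩ ⟨y, _⟩ hx' hr⟩
    · exact fun x y hx hr => hA _ _ hx hr
    · by_cases hx : ∃ h : x ∈ A, ⟨x, h⟩ ∈ B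
      · exact Or.inl hx
      · exact Or.inr ⟨hx, h⟩
    · rcases h with ⟨h, _⟩ | ⟨_, h⟩
      exacts [h, h]
  · rintro ⟨⟨A, hA⟩, ⟨B, hB⟩⟩ ⟨⟨C, hC⟩, ⟨D, hD⟩⟩ ⟨⟨C', hC'⟩, ⟨D', hD'⟩⟩ ⟨h1, h2⟩ ⟨g1, g2⟩
    dsimp only at h1 h2 g1 g2
    obtain rfl : C = C' := Set.ext fun x => (h2 x).trans (g2 x).symm
    obtain rfl : D = D' := Set.ext fun ⟨x, hx⟩ =>
      ⟨fun h => ((g1 x).1 ((h1 x).2 ⟨hx, h⟩)).2, fun h => ((h1 x).1 ((g1 x).2 ⟨hx, h⟩)).2⟩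
    rfl
  · rintro ⟨⟨A, hA⟩, ⟨B, hB⟩⟩ ⟨⟨A', hA'⟩, ⟨B', hB'⟩⟩ ⟨⟨C, hC⟩, ⟨D, hD⟩⟩ ⟨h1, h2⟩ ⟨g1, g2⟩
    dsimp only at h1 h2 g1 g2
    obtain rfl : A = A' := Set.ext fun x => (h1 x).trans (g1 x).symm
    obtain rfl : B = B' := Set.ext fun ⟨x, hx⟩ =>
      ⟨fun h => (((g2 x).1 ((h2 x).2 (Or.inr ⟨hx, h⟩))).resolve_left hx).2,
        fun h => (((h2 x).1 ((g2 x).2 (Or.inr ⟨hx, h⟩))).resolve_left hx).2⟩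
    rfl
  · rintro ⟨⟨A, hA⟩, ⟨B, hB⟩⟩ ⟨⟨C, hC⟩, ⟨D, hD⟩⟩ ⟨h1, h2⟩
    dsimp only at h1 h2 ⊢
    rw [dagElt_restrict_restrict, dagElt_restrict_restrict, dagElt_restrict_restrict,
      dagElt_restrict_restrict]
    have e1 : A = {x | ∃ h : x ∈ C, ⟨x, h⟩ ∈ D} := Set.ext h1
    have e2 : {x | ∃ h : x ∈ Aᶜ, ⟨x, h⟩ ∈ Bᶜ} = Cᶜ := Set.ext fun x => by
      simp only [Set.mem_ofPred_eq, Set.mem_compl_iff, h2 x, not_or, not_exists]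
      exact ⟨fun h => ⟨h.1, fun _ => h.2⟩, fun h => ⟨h.1, h.2 h.1⟩⟩
    have e3 : {x | ∃ h : x ∈ Aᶜ, ⟨x, h⟩ ∈ B} = {x | ∃ h : x ∈ C, ⟨x, h⟩ ∈ Dᶜ} :=
      Set.ext fun x => by
        constructor
        · rintro ⟨h, hB⟩
          exact ⟨(h2 x).2 (Or.inr ⟨h, hB⟩), fun hD => h ((h1 x).2 ⟨_, hD⟩)⟩
        · rintro ⟨h, hD⟩
          exact ((h2 x).1 h).resolve_left fun hx => hD ((h1 x).1 hx).2
    rw [e2, e3, ← e1]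

end OrdGraph

/-! ### The Hopf algebra of ordered graphs without cycle -/

section OrdAcyclicGraph

/-- The empty ordered graph. -/
def OrdAcyclicGraph.empty : OrdAcyclicGraph where
  V := Empty
  rel _ _ := False
  isSimple _ h := h
  acyclic := fun ⟨_, c, _⟩ => (c 0).elim
  tot _ _ := True
  isLinearOrder :=
    { refl := fun x => x.elim
      trans := fun x => x.elim
      antisymm := fun x => x.elim
      total := fun x => x.elim }

open Classical in
/-- The operations on ordered graphs without cycle. -/
noncomputable def OrdAcyclicGraph.ops {K : Type u} [Field K] (q : K) :
    ObjOps K OrdAcyclicGraph where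
  prod := OrdAcyclicGraph.product q
  cop := OrdAcyclicGraph.coproduct K
  one := OrdAcyclicGraph.empty
  counit G := if IsEmpty G.V then 1 else 0

variable {K : Type u} [Field K] (q : K)

open Classical in
theorem OrdAcyclicGraph.ops_respects : (OrdAcyclicGraph.ops q).Respects where
  prod_congr G G' H H' := by
    rintro ⟨e, he⟩ ⟨f, hf⟩
    change G.product q H = G'.product q H'
    rw [← OrdGraph.prodSum_toOrdGraph, ← OrdGraph.prodSum_toOrdGraph]
    exact OrdGraph.prodSum_congr q (f := e) (g := f) ⟨e.injective, fun _ _ => e.map_rel_iff, he⟩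
      e.surjective ⟨f.injective, fun _ _ => f.map_rel_iff, hf⟩ f.surjective
  cop_congr G G' := by
    rintro ⟨e, he⟩
    change G.coproduct K = G'.coproduct K
    rw [← OrdGraph.copSum_toOrdGraph, ← OrdGraph.copSum_toOrdGraph]
    exact OrdGraph.copSum_congr (f := e) ⟨e.injective, fun _ _ => e.map_rel_iff, he⟩ e.surjective
  counit_congr G G' := by
    rintro ⟨e, he⟩
    exact if_congr e.toEquiv.isEmpty_congr rfl rfl

/-! ### Structure maps on arbitrary ordered graphs, and local nilpotency -/

namespace OrdGraph

open OrdAcyclicGraph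

/-- The product formula holds even when a factor has a cycle, both sides being zero. It can
therefore be applied to every intermediate graph in the axioms. -/
theorem mul_dagElt (G H : OrdGraph) :
    (ops q).toBialgOps.mul (G.dagElt K) (H.dagElt K) = prodSum q G H := by
  rcases hasCycle_or_exists G with hG | ⟨X, rfl⟩
  · rw [dagElt_of_hasCycle hG, prodSum_left_of_hasCycle q H hG, LinearMap.map_zero₂]
  rcases hasCycle_or_exists H with hH | ⟨Y, rfl⟩
  · rw [dagElt_of_hasCycle hH, prodSum_right_of_hasCycle q _ hH, map_zero]
  rw [prodSum_toOrdGraph, dagElt_toOrdGraph, dagElt_toOrdGraph]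
  exact (ops_respects q).mul_elt X Y

theorem comul_dagElt (G : OrdGraph) : (ops q).toBialgOps.comul (G.dagElt K) = copSum K G := by
  rcases hasCycle_or_exists G with hG | ⟨X, rfl⟩
  · rw [dagElt_of_hasCycle hG, copSum_of_hasCycle hG, map_zero]
  rw [copSum_toOrdGraph, dagElt_toOrdGraph]
  exact (ops_respects q).comul_elt X

theorem dagElt_of_isEmpty (G : OrdGraph) [hG : IsEmpty G.V] :
    G.dagElt K = OrdAcyclicGraph.empty.elt K := by
  rw [← dagElt_toOrdGraph]
  exact dagElt_congr (f := fun x => (hG.false x).elim)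
    ⟨fun x => hG.elim x, fun x => hG.elim x, fun x => hG.elim x⟩ fun x => Empty.elim x

open Classical in
theorem counit_dagElt (G : OrdGraph) :
    (ops q).toBialgOps.counit (G.dagElt K) = if IsEmpty G.V then 1 else 0 := by
  rcases hasCycle_or_exists G with hG | ⟨X, rfl⟩
  -- A graph with a cycle has a vertex, so the right-hand side is also zero.
  · obtain ⟨x, -⟩ := hG.exists_transGen
    rw [dagElt_of_hasCycle hG, map_zero, if_neg fun h => h.false x]
  · rw [dagElt_toOrdGraph]
    exact (ops_respects q).counit_elt X

theorem counit_dagElt_of_nonempty (G : OrdGraph) (h : ¬ IsEmpty G.V) :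
    (ops q).toBialgOps.counit (G.dagElt K) = 0 := by
  rw [counit_dagElt, if_neg h]

theorem counit_dagElt_of_isEmpty (G : OrdGraph) (h : IsEmpty G.V) :
    (ops q).toBialgOps.counit (G.dagElt K) = 1 := by
  rw [counit_dagElt, if_pos h]

/-- There is a single gluing with a graph without vertices. -/
theorem IsGluing.prodSum_eq {G H Z : OrdGraph} {i : G.V → Z.V} {j : H.V → Z.V}
    (h : IsGluing G H Z i j) (he : IsEmpty G.V ∨ IsEmpty H.V) :
    prodSum q G H = Z.dagElt K := by
  obtain ⟨σ, hσ⟩ := exists_partialInj h.inl_inj h.inr_inj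
  have hsub : ∀ τ : PartialInj G.V H.V, τ = σ := fun τ => partialInj_ext fun v w =>
    he.elim (fun h => h.elim v) (fun h => h.elim w)
  have hc : σ.card = 0 := by
    refine Finset.card_eq_zero.2 (Finset.eq_empty_of_forall_notMem fun v hv => ?_)
    exact he.elim (fun h => h.elim v) (fun h => h.elim (σ.2 ⟨v, hv⟩))
  rw [prodSum, Fintype.sum_eq_single σ fun τ hτ => absurd (hsub τ) hτ, h.dagElt_eq hσ, hc,
    pow_zero, one_smul]

theorem isGluing_empty_left (G H : OrdGraph) [hG : IsEmpty G.V] :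
    IsGluing G H H (fun v => hG.elim v) id where
  inl_inj v := hG.elim v
  inr_inj := Function.injective_id
  exists_rep z := Or.inr ⟨z, rfl⟩
  rel_iff z z' := by simp
  tot_inl v := hG.elim v
  tot_inl_inr _ _ v := hG.elim v
  tot_inr _ _ _ _ h := h

theorem isGluing_empty_right (G H : OrdGraph) [hH : IsEmpty H.V] :
    IsGluing G H G id (fun w => hH.elim w) where
  inl_inj := Function.injective_id
  inr_inj w := hH.elim w
  exists_rep z := Or.inl ⟨z, rfl⟩
  rel_iff z z' := by simp
  tot_inl _ _ h := h
  tot_inl_inr w := hH.elim w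
  tot_inr w := hH.elim w

theorem dagElt_restrict_univ (G : OrdGraph) : (G.restrict Set.univ).dagElt K = G.dagElt K :=
  dagElt_congr (f := Subtype.val) ⟨Subtype.val_injective, fun _ _ => Iff.rfl, fun _ _ => Iff.rfl⟩
    fun x => ⟨⟨x, trivial⟩, rfl⟩

theorem isEmpty_restrict (G : OrdGraph) (A : Set G.V) : IsEmpty (G.restrict A).V ↔ A = ∅ :=
  Set.isEmpty_coe_sort

/-- In the coproduct, the term whose left factor is empty is killed by `η ∘ ε - id`. In every other
term the right factor has lost a vertex, so induction on the exponent applies. -/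
theorem augPow_dagElt (n : ℕ) (G : OrdGraph) (h : Nat.card G.V < n) :
    (ops q).toBialgOps.augPow n (G.dagElt K) = 0 := by
  induction n generalizing G with
  | zero => exact absurd h (Nat.not_lt_zero _)
  | succ n ih =>
    simp only [BialgOps.augPow, LinearMap.comp_apply, comul_dagElt, copSum, map_sum]
    refine Finset.sum_eq_zero fun A _ => ?_
    rw [TensorProduct.map_tmul, TensorProduct.lift.tmul]
    by_cases hA : IsEmpty (G.restrict A.1ᶜ).V
    · have : ((ops q).toBialgOps.counit.smulRight (ops q).toBialgOps.one -
          LinearMap.id : HOrdGraph K →ₗ[K] HOrdGraph K) ((G.restrict A.1ᶜ).dagElt K) = 0 := by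
        rw [LinearMap.sub_apply, LinearMap.smulRight_apply, counit_dagElt_of_isEmpty q _ hA,
          one_smul, LinearMap.id_apply, dagElt_of_isEmpty, sub_eq_zero]
        rfl
      rw [this, LinearMap.map_zero₂]
    · rw [ih, map_zero]
      have h1 : A.1 ≠ Set.univ := fun e => hA ((isEmpty_restrict _ _).2 (by simp [e]))
      have h2 : Nat.card (G.restrict A.1).V < Nat.card G.V :=
        Set.ncard_lt_card h1
      omega

end OrdGraph

open OrdGraph Classical in
theorem OrdAcyclicGraph.ops_isHopf : (OrdAcyclicGraph.ops q).IsHopf := by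
  have hr := OrdAcyclicGraph.ops_respects q
  have hprod : ∀ G H : OrdAcyclicGraph,
      (OrdAcyclicGraph.ops q).prod G H = prodSum q G.toOrdGraph H.toOrdGraph :=
    fun G H => (prodSum_toOrdGraph q G H).symm
  have hcop : ∀ G : OrdAcyclicGraph, (OrdAcyclicGraph.ops q).cop G = copSum K G.toOrdGraph :=
    fun G => (copSum_toOrdGraph G).symm
  have helt : ∀ G : OrdAcyclicGraph, ObjOps.basisElt K G = G.toOrdGraph.dagElt K :=
    fun G => (dagElt_toOrdGraph G).symm
  refine ⟨hr, hr.isBialgebra (fun G H L => ?_) (fun G => ?_) (fun G => ?_) (fun G => ?_)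
    (fun G => ?_) (fun G => ?_) ?_ (fun G H => ?_) ?_ (fun G H => ?_),
    ObjOps.isConilpotent_of_elt fun G => ⟨Nat.card G.V + 1, fun m hm => ?_⟩⟩
  · have key := sum_glue_assoc q G.toOrdGraph H.toOrdGraph L.toOrdGraph
    simp only [hprod, helt]
    rw [prodSum, prodSum]
    simp only [map_sum, map_smul, LinearMap.sum_apply, LinearMap.smul_apply, mul_dagElt]
    exact key
  · rw [hprod, helt]
    have : IsEmpty (OrdAcyclicGraph.ops q).one.toOrdGraph.V := inferInstanceAs (IsEmpty Empty)
    exact (isGluing_empty_left _ _).prodSum_eq q (Or.inl this)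
  · rw [hprod, helt]
    have : IsEmpty (OrdAcyclicGraph.ops q).one.toOrdGraph.V := inferInstanceAs (IsEmpty Empty)
    exact (isGluing_empty_right _ _).prodSum_eq q (Or.inr this)
  · have key := sum_copSum_restrict (K := K) G.toOrdGraph
    rw [hcop]
    nth_rw 1 2 [copSum]
    simp only [map_sum, LinearMap.rTensor_tmul, LinearMap.lTensor_tmul, comul_dagElt]
    exact key
  · rw [hcop, helt, copSum, map_sum, Fintype.sum_eq_single ⟨Set.univ, fun _ _ _ _ => trivial⟩]
    · rw [LinearMap.rTensor_tmul, dagElt_restrict_univ,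
        counit_dagElt_of_isEmpty q _ ((isEmpty_restrict _ _).2 Set.compl_univ)]
    · intro A hA
      rw [LinearMap.rTensor_tmul, counit_dagElt_of_nonempty, TensorProduct.zero_tmul]
      rw [isEmpty_restrict, Set.compl_empty_iff]
      exact fun e => hA (Subtype.ext e)
  · rw [hcop, helt, copSum, map_sum, Fintype.sum_eq_single ⟨∅, fun _ _ h _ => h⟩]
    · rw [LinearMap.lTensor_tmul, Set.compl_empty, dagElt_restrict_univ,
        counit_dagElt_of_isEmpty q _ ((isEmpty_restrict _ _).2 rfl)]
    · intro A hA
      rw [LinearMap.lTensor_tmul, counit_dagElt_of_nonempty, TensorProduct.tmul_zero]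
      rw [isEmpty_restrict]
      exact fun e => hA (Subtype.ext e)
  · exact if_pos (inferInstanceAs (IsEmpty Empty))
  · rw [← hr.counit_elt, ← hr.counit_elt, hprod, helt, helt]
    by_cases hG : IsEmpty G.toOrdGraph.V
    · rw [(isGluing_empty_left G.toOrdGraph H.toOrdGraph).prodSum_eq q (Or.inl hG),
        counit_dagElt_of_isEmpty q _ hG, one_mul]
    · rw [counit_dagElt_of_nonempty q _ hG, zero_mul, prodSum, map_sum]
      refine Finset.sum_eq_zero fun σ _ => ?_
      rw [map_smul, counit_dagElt_of_nonempty, smul_zero]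
      exact fun h => hG ⟨fun v => h.false (OrdGraph.glueInl _ _ σ v)⟩
  · have he : IsEmpty (OrdAcyclicGraph.ops q).one.toOrdGraph.V := inferInstanceAs (IsEmpty Empty)
    have hA : ∀ A : Set (OrdAcyclicGraph.ops q).one.toOrdGraph.V, A = Set.univ :=
      fun A => Set.ext fun x => he.elim x
    rw [hcop, helt, copSum, Fintype.sum_eq_single ⟨Set.univ, fun _ _ _ _ => trivial⟩
      fun A h => absurd (Subtype.ext (hA A.1)) h, hA Set.univᶜ, dagElt_restrict_univ]
  · have key := sum_copSum_glue q G.toOrdGraph H.toOrdGraph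
    rw [hprod, hcop, hcop]
    rw [prodSum, copSum, copSum]
    simp only [map_sum, map_smul, LinearMap.sum_apply, comul_dagElt,
      TensorProduct.map₂_apply_tmul, TensorProduct.map_tmul, mul_dagElt]
    exact key.trans Finset.sum_comm
  · rw [helt]
    exact augPow_dagElt q m G.toOrdGraph hm

end OrdAcyclicGraph

/-! ### Path orders of gluings and restrictions -/

namespace FinRel

/-- Loops deleted in the graph gluing are invisible to reflexive closures, and edges and paths
generate the same reachability. The transitive closure on the right is already reflexive, as every
vertex comes from a factor. -/
theorem reflTransGen_graphGlue {G H : FinRel} {σ : PartialInj G.V H.V} {x y : Glued σ} :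
    Relation.ReflTransGen (G.graphGlue H σ).rel x y ↔
      Relation.TransGen (unionRel G.pathOrder H.pathOrder σ) x y := by
  constructor
  · intro h
    have key : Relation.TransGen (unionRel G.pathOrder H.pathOrder σ) x x := by
      refine Relation.TransGen.single ?_
      rcases Glued.exists_rep σ x with ⟨v, rfl⟩ | ⟨w, rfl⟩
      · exact Or.inl ⟨v, v, Relation.ReflTransGen.refl, rfl, rfl⟩
      · exact Or.inr ⟨w, w, Relation.ReflTransGen.refl, rfl, rfl⟩
    induction h with
    | refl => exact key
    | tail _ h ih =>
      refine ih.tail ?_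
      rcases h.2 with ⟨v, v', h, e, e'⟩ | ⟨w, w', h, e, e'⟩
      · exact Or.inl ⟨v, v', Relation.ReflTransGen.single h, e, e'⟩
      · exact Or.inr ⟨w, w', Relation.ReflTransGen.single h, e, e'⟩
  · have edge : ∀ a b : Glued σ, unionRel G H σ a b →
        Relation.ReflTransGen (G.graphGlue H σ).rel a b := fun a b h => by
      by_cases hab : a = b
      · exact hab ▸ Relation.ReflTransGen.refl
      · exact Relation.ReflTransGen.single ⟨hab, h⟩
    have step : ∀ a b : Glued σ, unionRel G.pathOrder H.pathOrder σ a b →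
        Relation.ReflTransGen (G.graphGlue H σ).rel a b := by
      rintro a b (⟨v, v', h, rfl, rfl⟩ | ⟨w, w', h, rfl, rfl⟩)
      · exact Relation.ReflTransGen.lift' _
          (fun v v' h => edge _ _ (Or.inl ⟨v, v', h, rfl, rfl⟩)) _ _ h
      · exact Relation.ReflTransGen.lift' _
          (fun w w' h => edge _ _ (Or.inr ⟨w, w', h, rfl, rfl⟩)) _ _ h
    intro h
    induction h with
    | single h => exact step _ _ h
    | tail _ h ih => exact ih.trans (step _ _ h)

/-- Hence the products of graphs and of posets are sums over the same partial injections. -/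
theorem not_hasCycle_graphGlue_iff {G H : FinRel} {σ : PartialInj G.V H.V} :
    ¬ (G.graphGlue H σ).HasCycle ↔ (G.pathOrder.orderGlue H.pathOrder σ).IsPoset := by
  have hrel : (G.graphGlue H σ).pathOrder = G.pathOrder.orderGlue H.pathOrder σ := by
    simp only [pathOrder, orderGlue]
    congr 1
    funext x y
    exact propext reflTransGen_graphGlue
  rw [← hrel]
  constructor
  · exact pathOrder_isPoset (graphGlue_isSimple _ _ _)
  · intro h hc
    obtain ⟨x, y, hne, hxy, hyx⟩ := hc.exists_transGen
    exact hne (h.antisymm x y hxy.to_reflTransGen hyx.to_reflTransGen)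

theorem isIdeal_pathOrder_iff {G : FinRel} {A : Set G.V} :
    G.pathOrder.IsIdeal A ↔ G.IsIdeal A := by
  refine ⟨fun h x y hx hr => h x y hx (Relation.ReflTransGen.single hr), fun h x y hx hr => ?_⟩
  change Relation.ReflTransGen G.rel x y at hr
  induction hr with
  | refl => exact hx
  | tail _ hr ih => exact h _ _ ih hr

theorem reflTransGen_of_restrict {G : FinRel} {A : Set G.V} {x y : A}
    (h : Relation.ReflTransGen (G.restrict A).rel x y) : Relation.ReflTransGen G.rel x.1 y.1 :=
  Relation.ReflTransGen.lift Subtype.val (fun _ _ h => h) _ _ h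

/-- A path starting in an ideal stays there, so no path between two of its points is lost by
restricting. For an arbitrary subset a path could leave and return. -/
theorem IsIdeal.reflTransGen_restrict_iff {G : FinRel} {A : Set G.V} (hA : G.IsIdeal A)
    {x y : A} : Relation.ReflTransGen (G.restrict A).rel x y ↔
      Relation.ReflTransGen G.rel x.1 y.1 := by
  refine ⟨reflTransGen_of_restrict, fun h => ?_⟩
  have key : ∀ z, Relation.ReflTransGen G.rel x.1 z →
      ∃ hz : z ∈ A, Relation.ReflTransGen (G.restrict A).rel x ⟨z, hz⟩ := by
    intro z hz
    induction hz with
    | refl => exact ⟨x.2, Relation.ReflTransGen.refl⟩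
    | tail _ h ih => exact ⟨hA _ _ ih.1 h, ih.2.tail h⟩
  exact (key _ h).2

/-- A path that ends outside an ideal has never entered it. -/
theorem IsIdeal.reflTransGen_restrict_compl_iff {G : FinRel} {A : Set G.V} (hA : G.IsIdeal A)
    {x y : (Aᶜ : Set G.V)} : Relation.ReflTransGen (G.restrict Aᶜ).rel x y ↔
      Relation.ReflTransGen G.rel x.1 y.1 := by
  refine ⟨reflTransGen_of_restrict, fun h => ?_⟩
  have key : ∀ z, Relation.ReflTransGen G.rel x.1 z → (hz : z ∉ A) →
      Relation.ReflTransGen (G.restrict Aᶜ).rel x ⟨z, hz⟩ := by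
    intro z hz
    induction hz with
    | refl => exact fun _ => Relation.ReflTransGen.refl
    | tail _ h ih => exact fun hz => (ih fun hb => hz (hA _ _ hb h)).tail h
  exact key _ h y.2

/-- The graph of the strict order. -/
def strict (P : FinRel) : FinRel where
  V := P.V
  rel x y := P.rel x y ∧ x ≠ y

theorem strict_isSimple (P : FinRel) : P.strict.IsSimple := fun _ h => h.2 rfl

theorem IsPoset.reflTransGen_strict_iff {P : FinRel} (h : P.IsPoset) {x y : P.V} :
    Relation.ReflTransGen P.strict.rel x y ↔ P.rel x y := by
  constructor
  · intro hr
    induction hr with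
    | refl => exact h.refl x
    | tail _ hr ih => exact h.trans _ _ _ ih hr.1
  · intro hr
    by_cases hxy : x = y
    · exact hxy ▸ Relation.ReflTransGen.refl
    · exact Relation.ReflTransGen.single ⟨hr, hxy⟩

theorem IsPoset.not_hasCycle_strict {P : FinRel} (h : P.IsPoset) : ¬ P.strict.HasCycle := by
  intro hc
  obtain ⟨x, y, hne, hxy, hyx⟩ := hc.exists_transGen
  exact hne (h.antisymm x y (h.reflTransGen_strict_iff.1 hxy.to_reflTransGen)
    (h.reflTransGen_strict_iff.1 hyx.to_reflTransGen))

/-- An equality, not just an isomorphism: it supplies the exact preimages demanded by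
`IsCover.lift_equiv`. -/
theorem IsPoset.pathOrder_strict {P : FinRel} (h : P.IsPoset) : P.strict.pathOrder = P := by
  obtain ⟨V, r⟩ := P
  simp only [pathOrder, strict]
  congr 1
  funext x y
  exact propext h.reflTransGen_strict_iff

end FinRel

/-- Isomorphic graphs have isomorphic path orders. -/
def pathOrderIso {G H : FinRel} (e : G.rel ≃r H.rel) : G.pathOrder.rel ≃r H.pathOrder.rel where
  toEquiv := e.toEquiv
  map_rel_iff' := by
    intro (x : G.V) (y : G.V)
    change Relation.ReflTransGen H.rel (e x) (e y) ↔ Relation.ReflTransGen G.rel x y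
    constructor
    · intro h
      have := Relation.ReflTransGen.lift e.symm (fun _ _ h => e.symm.map_rel_iff.2 h) _ _ h
      change Relation.ReflTransGen G.rel (e.symm (e x)) (e.symm (e y)) at this
      rwa [e.symm_apply_apply, e.symm_apply_apply] at this
    · exact fun h => Relation.ReflTransGen.lift e (fun _ _ h => e.map_rel_iff.2 h) _ _ h

/-- The strict orders of isomorphic orders are isomorphic. -/
def strictIso {P Q : FinRel} (e : P.rel ≃r Q.rel) : P.strict.rel ≃r Q.strict.rel where
  toEquiv := e.toEquiv
  map_rel_iff' := and_congr e.map_rel_iff e.injective.ne_iff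

/-! ### Forgetting total orders and passing to path orders -/

section Covers

open ObjOps

theorem exists_isLinearOrder (V : Type) [Finite V] : ∃ r : V → V → Prop, IsLinearOrder V r := by
  obtain ⟨n, ⟨e⟩⟩ := Finite.exists_equiv_fin V
  exact ⟨fun x y => e x ≤ e y,
    { refl := fun x => le_refl _
      trans := fun x y z => le_trans
      antisymm := fun x y h h' => e.injective (le_antisymm h h')
      total := fun x y => le_total _ _ }⟩

theorem isLinearOrder_comap {V W : Type} {r : V → V → Prop} (h : IsLinearOrder V r)
    (e : W ≃ V) : IsLinearOrder W fun x y => r (e x) (e y) where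
  refl _ := h.refl _
  trans _ _ _ := h.trans _ _ _
  antisymm _ _ hx hy := e.injective (h.antisymm _ _ hx hy)
  total _ _ := h.total _ _

/-- Any total order on one graph, transported along the isomorphism, makes that isomorphism
order-preserving. -/
theorem OrdAcyclicGraph.isCover_toAcyclicGraph : IsCover OrdAcyclicGraph.toAcyclicGraph where
  map_equiv := fun _ _ ⟨e, _⟩ => ⟨e⟩
  lift_equiv := by
    rintro G G' ⟨e⟩
    obtain ⟨r, hr⟩ := exists_isLinearOrder G.V
    refine ⟨⟨G, r, hr⟩, ⟨G', _, isLinearOrder_comap hr e.symm.toEquiv⟩, ⟨e, fun x y => ?_⟩,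
      rfl, rfl⟩
    change r (e.symm (e x)) (e.symm (e y)) ↔ r x y
    rw [e.symm_apply_apply, e.symm_apply_apply]

theorem AcyclicGraph.isCover_toPoset : IsCover AcyclicGraph.toPoset where
  map_equiv := fun _ _ ⟨e⟩ => ⟨pathOrderIso e⟩
  lift_equiv := by
    have key : ∀ P : FinPoset, AcyclicGraph.toPoset
        ⟨P.toFinRel.strict, P.strict_isSimple, P.isPoset.not_hasCycle_strict⟩ = P := by
      rintro ⟨P, hP⟩
      simp only [AcyclicGraph.toPoset, hP.pathOrder_strict]
    rintro P P' ⟨e⟩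
    exact ⟨_, _, ⟨strictIso e⟩, key P, key P'⟩

theorem OrdAcyclicGraph.isCover_toOrdPoset : IsCover OrdAcyclicGraph.toOrdPoset where
  map_equiv := fun _ _ ⟨e, he⟩ => ⟨pathOrderIso e, he⟩
  lift_equiv := by
    have key : ∀ P : OrdFinPoset, OrdAcyclicGraph.toOrdPoset
        ⟨⟨P.toFinRel.strict, P.strict_isSimple, P.isPoset.not_hasCycle_strict⟩, P.tot,
          P.isLinearOrder⟩ = P := by
      rintro ⟨⟨⟨V, r⟩, hP⟩, t, ht⟩
      have : Relation.ReflTransGen (fun x y => r x y ∧ x ≠ y) = r := by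
        funext x y
        exact propext hP.reflTransGen_strict_iff
      -- Generalizing the relation lets it be substituted although the proof of `IsPoset` depends on
      -- it.
      have aux : ∀ (r' : V → V → Prop) (h : FinRel.IsPoset ⟨V, r'⟩), r' = r →
          (⟨⟨⟨V, r'⟩, h⟩, t, ht⟩ : OrdFinPoset) = ⟨⟨⟨V, r⟩, hP⟩, t, ht⟩ := by
        rintro _ _ rfl
        rfl
      exact aux _ _ this
    rintro P P' ⟨e, he⟩
    exact ⟨_, _, ⟨strictIso e, he⟩, key P, key P'⟩

/-! ### Operations on the three quotient families and their compatibility -/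

variable {K : Type u} [Field K] (q : K)

theorem OrdAcyclicGraph.linearMap_toAcyclicGraph_elt (G : OrdAcyclicGraph) :
    OrdAcyclicGraph.isCover_toAcyclicGraph.linearMap K (G.elt K) = G.toAcyclicGraph.elt K :=
  OrdAcyclicGraph.isCover_toAcyclicGraph.linearMap_elt G

theorem AcyclicGraph.linearMap_toPoset_elt (G : AcyclicGraph) :
    AcyclicGraph.isCover_toPoset.linearMap K (G.elt K) = G.toPoset.elt K :=
  AcyclicGraph.isCover_toPoset.linearMap_elt G

theorem OrdAcyclicGraph.linearMap_toOrdPoset_elt (G : OrdAcyclicGraph) :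
    OrdAcyclicGraph.isCover_toOrdPoset.linearMap K (G.elt K) = G.toOrdPoset.elt K :=
  OrdAcyclicGraph.isCover_toOrdPoset.linearMap_elt G

open Classical in
/-- The operations on graphs without cycle. -/
noncomputable def AcyclicGraph.ops : ObjOps K AcyclicGraph where
  prod := AcyclicGraph.product q
  cop := AcyclicGraph.coproduct K
  one := OrdAcyclicGraph.empty.toAcyclicGraph
  counit G := if IsEmpty G.V then 1 else 0

open Classical in
/-- The operations on posets. -/
noncomputable def FinPoset.ops : ObjOps K FinPoset where
  prod := FinPoset.product q
  cop := FinPoset.coproduct K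
  one := OrdAcyclicGraph.empty.toAcyclicGraph.toPoset
  counit G := if IsEmpty G.V then 1 else 0

open Classical in
/-- The operations on ordered posets. -/
noncomputable def OrdFinPoset.ops : ObjOps K OrdFinPoset where
  prod := OrdFinPoset.product q
  cop := OrdFinPoset.coproduct K
  one := OrdAcyclicGraph.empty.toOrdPoset
  counit G := if IsEmpty G.V then 1 else 0

open Classical in
theorem OrdAcyclicGraph.toAcyclicGraph_compatible :
    OrdAcyclicGraph.isCover_toAcyclicGraph.Compatible (OrdAcyclicGraph.ops q)
      (AcyclicGraph.ops q) where
  prod G H := by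
    refine Eq.trans ?_ (map_sum _ _ _).symm
    refine Finset.sum_congr rfl fun σ _ => ?_
    rw [map_smul, OrdAcyclicGraph.linearMap_toAcyclicGraph_elt]
  cop G := by
    refine Eq.trans ?_ (map_sum _ _ _).symm
    refine Finset.sum_congr rfl fun A _ => ?_
    rw [TensorProduct.map_tmul, OrdAcyclicGraph.linearMap_toAcyclicGraph_elt,
      OrdAcyclicGraph.linearMap_toAcyclicGraph_elt]
    rfl
  one := Setoid.refl _
  counit _ := rfl

-- The index sets of both sums coincide, for gluings and for ideals alike. The terms match because
-- path orders commute with gluing and with restriction to an ideal or to its complement.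
open Classical in
theorem AcyclicGraph.toPoset_compatible :
    AcyclicGraph.isCover_toPoset.Compatible (AcyclicGraph.ops q) (FinPoset.ops q) where
  prod G H := by
    refine Eq.trans ?_ (map_sum _ _ _).symm
    refine Fintype.sum_equiv
      (Equiv.subtypeEquivRight fun σ => FinRel.not_hasCycle_graphGlue_iff.symm) _ _ fun σ => ?_
    rw [map_smul, AcyclicGraph.linearMap_toPoset_elt]
    refine congrArg (q ^ σ.1.card • ·) ?_
    refine congrArg (Finsupp.single · 1) (Quotient.sound ?_)
    exact ⟨⟨Equiv.refl _, FinRel.reflTransGen_graphGlue⟩⟩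
  cop G := by
    refine Eq.trans ?_ (map_sum _ _ _).symm
    let e : {A : Set G.toPoset.V // G.toPoset.IsIdeal A} ≃ {A : Set G.V // G.IsIdeal A} :=
      Equiv.subtypeEquivRight fun _ => FinRel.isIdeal_pathOrder_iff
    refine Fintype.sum_equiv e _ _ fun A => ?_
    have hA := FinRel.isIdeal_pathOrder_iff.1 A.2
    rw [TensorProduct.map_tmul, AcyclicGraph.linearMap_toPoset_elt,
      AcyclicGraph.linearMap_toPoset_elt]
    refine congrArg₂ (· ⊗ₜ[K] ·) ?_ ?_
    · refine congrArg (Finsupp.single · 1) (Quotient.sound ?_)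
      exact ⟨⟨Equiv.refl _, hA.reflTransGen_restrict_compl_iff⟩⟩
    · refine congrArg (Finsupp.single · 1) (Quotient.sound ?_)
      exact ⟨⟨Equiv.refl _, hA.reflTransGen_restrict_iff⟩⟩
  one := Setoid.refl _
  counit _ := rfl

open Classical in
theorem OrdAcyclicGraph.toOrdPoset_compatible :
    OrdAcyclicGraph.isCover_toOrdPoset.Compatible (OrdAcyclicGraph.ops q)
      (OrdFinPoset.ops q) where
  prod G H := by
    refine Eq.trans ?_ (map_sum _ _ _).symm
    refine Fintype.sum_equiv
      (Equiv.subtypeEquivRight fun σ => FinRel.not_hasCycle_graphGlue_iff.symm) _ _ fun σ => ?_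
    rw [map_smul, OrdAcyclicGraph.linearMap_toOrdPoset_elt]
    refine congrArg (q ^ σ.1.card • ·) ?_
    refine congrArg (Finsupp.single · 1) (Quotient.sound ?_)
    exact ⟨⟨Equiv.refl _, FinRel.reflTransGen_graphGlue⟩, fun _ _ => Iff.rfl⟩
  cop G := by
    refine Eq.trans ?_ (map_sum _ _ _).symm
    let e : {A : Set G.toOrdPoset.V // G.toOrdPoset.IsIdeal A} ≃ {A : Set G.V // G.IsIdeal A} :=
      Equiv.subtypeEquivRight fun _ => FinRel.isIdeal_pathOrder_iff
    refine Fintype.sum_equiv e _ _ fun A => ?_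
    have hA := FinRel.isIdeal_pathOrder_iff.1 A.2
    rw [TensorProduct.map_tmul, OrdAcyclicGraph.linearMap_toOrdPoset_elt,
      OrdAcyclicGraph.linearMap_toOrdPoset_elt]
    refine congrArg₂ (· ⊗ₜ[K] ·) ?_ ?_
    · refine congrArg (Finsupp.single · 1) (Quotient.sound ?_)
      exact ⟨⟨Equiv.refl _, hA.reflTransGen_restrict_compl_iff⟩, fun _ _ => Iff.rfl⟩
    · refine congrArg (Finsupp.single · 1) (Quotient.sound ?_)
      exact ⟨⟨Equiv.refl _, hA.reflTransGen_restrict_iff⟩, fun _ _ => Iff.rfl⟩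
  one := Setoid.refl _
  counit _ := rfl

end Covers

end GluingHopf

theorem mainTheorem10 (K : Type u) [Field K] (q : K) :
    -- commutative version
    (∃ (HG : Type (max 1 u)) (_ : Ring HG) (_ : HopfAlgebra K HG)
        (HP : Type (max 1 u)) (_ : Ring HP) (_ : HopfAlgebra K HP)
        (g : GluingHopf.HGraph K ≃ₗ[K] HG) (p : GluingHopf.HPoset K ≃ₗ[K] HP),
      -- the Hopf algebra of posets
      (∀ P Q : GluingHopf.FinPoset, p (P.elt K) * p (Q.elt K) = p (P.product q Q)) ∧
      (∀ P : GluingHopf.FinPoset, Coalgebra.comul (R := K) (p (P.elt K)) =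
        TensorProduct.map p.toLinearMap p.toLinearMap (P.coproduct K)) ∧
      -- the Hopf algebra of simple oriented graphs with no cycle
      (∀ G H : GluingHopf.AcyclicGraph, g (G.elt K) * g (H.elt K) = g (G.product q H)) ∧
      (∀ G : GluingHopf.AcyclicGraph, Coalgebra.comul (R := K) (g (G.elt K)) =
        TensorProduct.map g.toLinearMap g.toLinearMap (G.coproduct K)) ∧
      -- the Hopf algebra morphism sending a graph to its path order
      ∃ φ : HG →ₐc[K] HP, (∀ G : GluingHopf.AcyclicGraph, φ (g (G.elt K)) = p (G.toPoset.elt K)) ∧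
        ∀ x : HG, φ (HopfAlgebra.antipode K x) = HopfAlgebra.antipode K (φ x)) ∧
    -- noncommutative version
    (∃ (HG : Type (max 1 u)) (_ : Ring HG) (_ : HopfAlgebra K HG)
        (HP : Type (max 1 u)) (_ : Ring HP) (_ : HopfAlgebra K HP)
        (g : GluingHopf.HOrdGraph K ≃ₗ[K] HG) (p : GluingHopf.HOrdPoset K ≃ₗ[K] HP),
      (∀ P Q : GluingHopf.OrdFinPoset, p (P.elt K) * p (Q.elt K) = p (P.product q Q)) ∧
      (∀ P : GluingHopf.OrdFinPoset, Coalgebra.comul (R := K) (p (P.elt K)) =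
        TensorProduct.map p.toLinearMap p.toLinearMap (P.coproduct K)) ∧
      (∀ G H : GluingHopf.OrdAcyclicGraph, g (G.elt K) * g (H.elt K) = g (G.product q H)) ∧
      (∀ G : GluingHopf.OrdAcyclicGraph, Coalgebra.comul (R := K) (g (G.elt K)) =
        TensorProduct.map g.toLinearMap g.toLinearMap (G.coproduct K)) ∧
      ∃ φ : HG →ₐc[K] HP,
        (∀ G : GluingHopf.OrdAcyclicGraph, φ (g (G.elt K)) = p (G.toOrdPoset.elt K)) ∧
        ∀ x : HG, φ (HopfAlgebra.antipode K x) = HopfAlgebra.antipode K (φ x)) := by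
  -- The unordered case first descends from ordered to unordered graphs, then to posets; the ordered
  -- case needs only the path-order map.
  exact ⟨(GluingHopf.AcyclicGraph.toPoset_compatible q).exists_hopfAlgebra
      ((GluingHopf.OrdAcyclicGraph.toAcyclicGraph_compatible q).isHopf
        (GluingHopf.OrdAcyclicGraph.ops_isHopf q)),
    (GluingHopf.OrdAcyclicGraph.toOrdPoset_compatible q).exists_hopfAlgebra
      (GluingHopf.OrdAcyclicGraph.ops_isHopf q)⟩
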